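/- Let $U=\{(\alpha,\beta)\in\mathbb R^2: 0<\beta\le\alpha\le 1\}$ and, for $(\alpha,\beta)\in U$, let $T_{\alpha,\beta}:[0,1]\to[0,1]$ be the interval translation map $$T_{\alpha,\beta}(x)=\begin{cases}x+\alpha,& x\in[0,1-\alpha),\\ x+\beta,& x\in[1-\alpha,1-\beta),\\ x-1+\beta,& x\in[1-\beta,1].\end{cases}$$ Let $G(\alpha,\beta)=\left(\frac{\beta}{\alpha},\ \frac{\beta-1}{\alpha}+\left\lfloor\frac1\alpha\right\rfloor\right)$ and let $\Omega_\infty=\{(\alpha,\beta): G^n(\alpha,\beta)\in U^\circ\text{ for all }n\ge 0\}$ be the set of parameters of infinite type, with the topology induced from $\mathbb R^2$. Let $X_{\alpha,\beta}\subset\{1,2,3\}^{\mathbb N}$ be the closure of the orbit, under the left shift $\sigma$, of the itinerary of the point $1$ under $T_{\alpha,\beta}$ with respect to the partition $[0,1-\alpha),[1-\alpha,1-\beta),[1-\beta,1]$ with symbols $1,2,3$. Call $c\in\mathbb C$ an eigenvalue of $T_{\alpha,\beta}$ if it is a continuous eigenvalue, that is, there is a continuous $f:X_{\alpha,\beta}\to\mathbb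 C$, $f\not\equiv 0$, with $f\circ\sigma=cf$, or a measurable eigenvalue, that is, there are a $T_{\alpha,\beta}$-invariant Borel probability measure $\mu$ on $[0,1]$ and a nonzero $f\in L^2(\mu)$ with $f\circ T_{\alpha,\beta}=cf$ $\mu$-almost everywhere. Then the set of parameters $(\alpha,\beta)\in\Omega_\infty$ for which $T_{\alpha,\beta}$ has no eigenvalue $e^{2\pi i\xi}$ with $\xi\in(0,1)$ contains a dense $G_\delta$ subset of $\Omega_\infty$. -/

import Mathlib

open MeasureTheory

noncomputable section

namespace ITM

/-- The parameter space `U = {(α, β) : 0 < β ≤ α ≤ 1}`. -/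
def U : Set (ℝ × ℝ) := {p | 0 < p.2 ∧ p.2 ≤ p.1 ∧ p.1 ≤ 1}

/-- The renormalization map `G(α, β) = (β/α, (β - 1)/α + ⌊1/α⌋)`. -/
def G (p : ℝ × ℝ) : ℝ × ℝ :=
  (p.2 / p.1, (p.2 - 1) / p.1 + (⌊1 / p.1⌋ : ℝ))

/-- The parameters of infinite type: all iterates of `G` stay in the interior of `U`. -/
def OmegaInfty : Set (ℝ × ℝ) := {p | ∀ n : ℕ, G^[n] p ∈ interior U}

/-- The interval translation map `T_{α,β}`. Only its values on `[0, 1]` matter. -/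
def T (p : ℝ × ℝ) (x : ℝ) : ℝ :=
  if x < 1 - p.1 then x + p.1
  else if x < 1 - p.2 then x + p.2
  else x - 1 + p.2

/-- The symbol of the partition element `[0, 1 - α)`, `[1 - α, 1 - β)`, `[1 - β, 1]`
that contains the point; the symbols `0, 1, 2` stand for `1, 2, 3`. -/
def symbol (p : ℝ × ℝ) (x : ℝ) : Fin 3 :=
  if x < 1 - p.1 then 0 else if x < 1 - p.2 then 1 else 2

/-- The itinerary of `x` under `T_{α,β}`. -/
def itinerary (p : ℝ × ℝ) (x : ℝ) : ℕ → Fin 3 := fun n => symbol p ((T p)^[n] x)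

/-- The left shift on one-sided sequences. -/
def shift (x : ℕ → Fin 3) : ℕ → Fin 3 := fun n => x (n + 1)

/-- The subshift of `T_{α,β}`: the shift-orbit closure, in the product topology, of the
itinerary of the point `1`. -/
def subshift (p : ℝ × ℝ) : Set (ℕ → Fin 3) :=
  closure (Set.range fun n : ℕ => shift^[n] (itinerary p 1))

/-- `c` is a continuous eigenvalue: the Koopman operator of the subshift has a nonzero continuous
eigenfunction with eigenvalue `c`. -/
def IsContinuousEigenvalue (p : ℝ × ℝ) (c : ℂ) : Prop :=
  ∃ f : (ℕ → Fin 3) → ℂ, ContinuousOn f (subshift p) ∧ (∃ x ∈ subshift p, f x ≠ 0) ∧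
    ∀ x ∈ subshift p, f (shift x) = c * f x

/-- `c` is a measurable eigenvalue: for some `T_{α,β}`-invariant Borel probability measure `μ` on
`[0, 1]`, the Koopman operator on `L²(μ)` has a nonzero eigenfunction with eigenvalue `c`. -/
def IsMeasurableEigenvalue (p : ℝ × ℝ) (c : ℂ) : Prop :=
  ∃ μ : Measure ℝ, IsProbabilityMeasure μ ∧ μ (Set.Icc 0 1)ᶜ = 0 ∧ MeasurePreserving (T p) μ μ ∧
    ∃ f : ℝ → ℂ, MemLp f 2 μ ∧ ¬ (f =ᵐ[μ] 0) ∧ ∀ᵐ x ∂μ, f (T p x) = c * f x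

/-- `c` is an eigenvalue of `T_{α,β}`, continuous or measurable. -/
def IsEigenvalue (p : ℝ × ℝ) (c : ℂ) : Prop :=
  IsContinuousEigenvalue p c ∨ IsMeasurableEigenvalue p c

end ITM

end

/-!
The renormalization `G` assigns to a parameter of infinite type the sequence of its digits
`⌊1 / α⌋` along the `G`-orbit. Every finite sequence of positive integers occurs as an initial
segment, and the inverse branches of `G` contract, so parameters with a long common initial segment
are close. The first return map of `T_{α,β}` to `[1 - α, 1]` is a rescaled copy of `T_{G(α,β)}`, so
the digits give substitutions that generate the itineraries.

Choosing four consecutive digits suitably, we obtain two words of coprime lengths `v` and `w` such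
that every orbit spends a fixed fraction of its time in long repetitions of each of them. If
`j * v = i * w + 1` with `i ≤ v` and `j ≤ w`, then a fixed portion of every orbit almost repeats
itself both after the time `a = i * w` and after the time `a + 1 = j * v`. If this happens at
infinitely many levels, an eigenvalue `c` of modulus `1` satisfies `c ^ a → 1` and
`c ^ (a + 1) → 1`, whence `c = 1`. Each such level is an open condition on the parameter, and the
existence of arbitrarily high such levels is a dense one, so Baire's theorem applies.
-/

namespace ITM

open Filter Topology

section Arithmetic

theorem exists_coprime_add_mul {a b c : ℕ} (hb : b ≠ 0) (h : b.Coprime (a.gcd c)) :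
    ∃ k, 1 ≤ k ∧ b.Coprime (c + k * a) := by
  refine ⟨∏ q ∈ b.primeFactors with ¬ q ∣ c, q, ?_, Nat.coprime_of_dvd fun q hq hqb hqs => ?_⟩
  · exact Finset.prod_pos fun q hq =>
      (Nat.prime_of_mem_primeFactors (Finset.mem_filter.1 hq).1).pos
  by_cases hqc : q ∣ c
  · rcases hq.dvd_mul.1 ((Nat.dvd_add_right hqc).1 hqs) with hqk | hqa
    · obtain ⟨r, hr, hqr⟩ := (hq.prime.dvd_finsetProd_iff _).1 hqk
      obtain ⟨hrb, hrc⟩ := Finset.mem_filter.1 hr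
      rw [Nat.prime_dvd_prime_iff_eq hq (Nat.prime_of_mem_primeFactors hrb)] at hqr
      exact hrc (hqr ▸ hqc)
    · exact Nat.not_coprime_of_dvd_of_dvd hq.one_lt hqb (Nat.dvd_gcd hqa hqc) h
  · have hqk : q ∣ ∏ q ∈ b.primeFactors with ¬ q ∣ c, q :=
      Finset.dvd_prod_of_mem _ (Finset.mem_filter.2 ⟨Nat.mem_primeFactors.2 ⟨hq, hqb, hb⟩, hqc⟩)
    exact hqc ((Nat.dvd_add_left (hqk.mul_right a)).1 hqs)

theorem exists_mul_eq_mul_add_one {v w : ℕ} (hv : 0 < v) (hw : 0 < w) (h : v.Coprime w) :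
    ∃ i ≤ v, ∃ j ≤ w, j * v = i * w + 1 := by
  obtain rfl | h1 : w = 1 ∨ 1 < w := by omega
  · exact ⟨v - 1, by omega, 1, le_rfl, by omega⟩
  · obtain ⟨j, hj, hmod⟩ := Nat.exists_mul_mod_eq_one_of_coprime h h1
    have hdiv := Nat.div_add_mod (v * j) w
    refine ⟨v * j / w, Nat.div_le_of_le_mul ?_, j, hj.le, ?_⟩
    · rw [mul_comm w]
      gcongr
    · rw [mul_comm j, mul_comm _ w, ← hmod, hdiv]

end Arithmetic

/-! ### Visit frequencies -/

section Visits

variable {X : Type*} {f : X → X} {g : X → ℝ} {A B Y : Set X} {δ : ℝ}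

theorem birkhoffSum_nonneg (hg : ∀ x, 0 ≤ g x) (m : ℕ) (x : X) : 0 ≤ birkhoffSum f g m x :=
  Finset.sum_nonneg fun _ _ => hg _

theorem mul_sub_le_birkhoffSum_of_return (hg : ∀ x, 0 ≤ g x) (hδ : 0 ≤ δ) {M : ℕ}
    (hB : ∀ x ∈ B, ∃ h, 0 < h ∧ h ≤ M ∧ f^[h] x ∈ B ∧ δ * h ≤ birkhoffSum f g h x)
    (m : ℕ) {x : X} (hx : x ∈ B) : δ * (m - M) ≤ birkhoffSum f g m x := by
  induction m using Nat.strong_induction_on generalizing x with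
  | _ m ih =>
    obtain ⟨h, hpos, hM, hret, hsum⟩ := hB x hx
    rcases lt_or_ge m h with hlt | hge
    · have hmM : (m : ℝ) ≤ M := by exact_mod_cast hlt.le.trans hM
      exact (mul_nonpos_of_nonneg_of_nonpos hδ (by linarith)).trans (birkhoffSum_nonneg hg m x)
    · obtain ⟨r, rfl⟩ := Nat.exists_eq_add_of_le hge
      have hr := ih r (by omega) hret
      rw [birkhoffSum_add]
      push_cast
      linarith

theorem natCast_le_birkhoffSum_indicator {a m n : ℕ} {x : X} (hn : a + m ≤ n)
    (h : ∀ t < m, f^[a + t] x ∈ A) : (m : ℝ) ≤ birkhoffSum f (A.indicator 1) n x := by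
  have hsub : Finset.Ico a (a + m) ⊆ Finset.range n := fun i hi => by
    have := Finset.mem_Ico.1 hi
    exact Finset.mem_range.2 (by omega)
  calc (m : ℝ) = ∑ i ∈ Finset.Ico a (a + m), A.indicator (1 : X → ℝ) (f^[i] x) := by
        rw [Finset.sum_Ico_eq_sum_range, add_tsub_cancel_left, Finset.sum_congr rfl fun t ht =>
          Set.indicator_of_mem (h t (Finset.mem_range.1 ht)) _]
        simp
    _ ≤ birkhoffSum f (A.indicator 1) n x :=
        Finset.sum_le_sum_of_subset_of_nonneg hsub fun _ _ _ =>
          Set.indicator_nonneg (fun _ _ => zero_le_one) _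

/-- The orbits of the points of `Y` visit `A` with lower frequency at least `δ`, uniformly: the
number of visits up to time `m` is at least `δ * m` up to a constant independent of the point. -/
def VisitsWithFrequency (f : X → X) (Y A : Set X) (δ : ℝ) : Prop :=
  ∃ C : ℝ, ∀ x ∈ Y, ∀ m : ℕ, δ * m - C ≤ birkhoffSum f (A.indicator 1) m x

theorem visitsWithFrequency_of_return (hδ : 0 ≤ δ) {M R : ℕ}
    (hB : ∀ x ∈ B, ∃ h, 0 < h ∧ h ≤ M ∧ f^[h] x ∈ B ∧ δ * h ≤ birkhoffSum f (A.indicator 1) h x)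
    (hY : ∀ x ∈ Y, ∃ t ≤ R, f^[t] x ∈ B) : VisitsWithFrequency f Y A δ := by
  have hnonneg : ∀ x, 0 ≤ A.indicator (1 : X → ℝ) x :=
    Set.indicator_nonneg fun _ _ => zero_le_one
  refine ⟨δ * (R + M), fun x hx m => ?_⟩
  obtain ⟨t, htR, htB⟩ := hY x hx
  have htail := mul_sub_le_birkhoffSum_of_return hnonneg hδ hB (m - t) htB
  have hm : (m : ℝ) ≤ (m - t : ℕ) + R := by exact_mod_cast (by omega : m ≤ m - t + R)
  calc δ * m - δ * (R + M) = δ * (m - R - M) := by ring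
    _ ≤ δ * ((m - t : ℕ) - M) := by gcongr; linarith
    _ ≤ birkhoffSum f (A.indicator 1) (m - t) (f^[t] x) := htail
    _ ≤ birkhoffSum f (A.indicator 1) m x := ?_
  rcases le_total m t with hmt | htm
  · rw [Nat.sub_eq_zero_of_le hmt, birkhoffSum_zero]
    exact birkhoffSum_nonneg hnonneg m x
  · conv_rhs => rw [← Nat.add_sub_cancel' htm, birkhoffSum_add]
    exact le_add_of_nonneg_left (birkhoffSum_nonneg hnonneg t x)

theorem VisitsWithFrequency.mono (h : VisitsWithFrequency f Y A δ) (hAB : A ⊆ B) :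
    VisitsWithFrequency f Y B δ := by
  obtain ⟨C, hC⟩ := h
  exact ⟨C, fun x hx m => (hC x hx m).trans (Finset.sum_le_sum fun _ _ =>
    Set.indicator_le_indicator_of_subset hAB (fun _ => zero_le_one) _)⟩

theorem VisitsWithFrequency.exists_iterate_mem (h : VisitsWithFrequency f Y A δ) (hδ : 0 < δ)
    {x : X} (hx : x ∈ Y) : ∃ i, f^[i] x ∈ A := by
  by_contra! hA
  obtain ⟨C, hC⟩ := h
  obtain ⟨m, hm⟩ := exists_nat_gt (C / δ)
  have hzero : birkhoffSum f (A.indicator (1 : X → ℝ)) m x = 0 :=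
    Finset.sum_eq_zero fun i _ => Set.indicator_of_notMem (hA i) _
  have hle := hC x hx m
  rw [div_lt_iff₀ hδ] at hm
  linarith

end Visits

/-! ### Eigenfunctions and almost periods -/

theorem eq_one_of_tendsto_pow {M : Type*} [Monoid M] [TopologicalSpace M] [ContinuousMul M]
    [T2Space M] {c : M} {a : ℕ → ℕ} (h : Tendsto (fun l => c ^ a l) atTop (𝓝 1))
    (h' : Tendsto (fun l => c ^ (a l + 1)) atTop (𝓝 1)) : c = 1 := by
  have hc : Tendsto (fun l => c ^ (a l + 1)) atTop (𝓝 (1 * c)) := by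
    simpa only [pow_succ] using h.mul_const c
  simpa only [one_mul] using tendsto_nhds_unique hc h'

section MeasurableEigenfunctions

variable {X E : Type*} [NormedAddCommGroup E]

section InvariantIntegrals

variable [MeasurableSpace X] {μ : Measure X} {S : X → X}

theorem integral_comp_of_measurePreserving [NormedSpace ℝ E] (hS : MeasurePreserving S μ μ)
    {φ : X → E} (hφ : AEStronglyMeasurable φ μ) : ∫ x, φ (S x) ∂μ = ∫ x, φ x ∂μ := by
  rw [← integral_map hS.aemeasurable (hS.map_eq.symm ▸ hφ), hS.map_eq]

theorem ae_comp_iterate_eq_pow_mul {M : Type*} [Monoid M]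
    (hS : Measure.QuasiMeasurePreserving S μ μ) {c : M} {φ : X → M}
    (hφ : ∀ᵐ x ∂μ, φ (S x) = c * φ x) (n : ℕ) : ∀ᵐ x ∂μ, φ (S^[n] x) = c ^ n * φ x := by
  induction n with
  | zero => simp
  | succ n ih =>
    filter_upwards [ih, (hS.iterate n).ae hφ] with x hn hstep
    rw [Function.iterate_succ_apply', hstep, hn, pow_succ', mul_assoc]

theorem integral_mul_comp_iterate (hS : MeasurePreserving S μ μ) {e g : X → ℝ}
    (he : AEStronglyMeasurable e μ) (hinv : ∀ᵐ x ∂μ, e (S x) = e x)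
    (hg : AEStronglyMeasurable g μ) (n : ℕ) :
    ∫ x, e x * g (S^[n] x) ∂μ = ∫ x, e x * g x ∂μ := by
  have hiter := ae_comp_iterate_eq_pow_mul (φ := e) (c := 1) hS.quasiMeasurePreserving
    (by simpa only [one_mul] using hinv) n
  refine Eq.trans (integral_congr_ae ?_)
    (integral_comp_of_measurePreserving (hS.iterate n) (he.mul hg))
  filter_upwards [hiter] with x hx
  rw [hx, one_pow, one_mul]

theorem VisitsWithFrequency.mul_integral_le_setIntegral {Y A : Set X} {δ : ℝ}
    (h : VisitsWithFrequency S Y A δ) (hY : ∀ᵐ x ∂μ, x ∈ Y) (hA : MeasurableSet A)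
    (hS : MeasurePreserving S μ μ) {e : X → ℝ} (he : Integrable e μ) (hpos : ∀ x, 0 ≤ e x)
    (hinv : ∀ᵐ x ∂μ, e (S x) = e x) : δ * ∫ x, e x ∂μ ≤ ∫ x in A, e x ∂μ := by
  obtain ⟨C, hC⟩ := h
  have hmeas : Measurable (A.indicator (1 : X → ℝ)) := measurable_one.indicator hA
  have hint (i : ℕ) : Integrable (fun x => e x * A.indicator 1 (S^[i] x)) μ :=
    he.mul_bdd (c := 1) (hmeas.comp (hS.measurable.iterate i)).aestronglyMeasurable
      (.of_forall fun x => (norm_indicator_le_norm_self _ _).trans (by simp))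
  have hsum (m : ℕ) :
      ∫ x, e x * birkhoffSum S (A.indicator 1) m x ∂μ = m * ∫ x in A, e x ∂μ := by
    have hone : ∫ x, e x * A.indicator 1 x ∂μ = ∫ x in A, e x ∂μ := by
      rw [← integral_indicator hA]
      congr with x
      by_cases hx : x ∈ A <;> simp [hx]
    simp only [birkhoffSum, Finset.mul_sum]
    rw [integral_finsetSum _ fun i _ => hint i]
    simp [integral_mul_comp_iterate hS he.1 hinv hmeas.aestronglyMeasurable, hone]
  have hbound (m : ℕ) : (δ * m - C) * ∫ x, e x ∂μ ≤ m * ∫ x in A, e x ∂μ := by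
    rw [← hsum m, ← integral_const_mul]
    refine integral_mono_ae (he.const_mul _) ?_ ?_
    · simp only [birkhoffSum, Finset.mul_sum]
      exact integrable_finsetSum _ fun i _ => hint i
    · filter_upwards [hY] with x hx
      rw [mul_comm]
      exact mul_le_mul_of_nonneg_left (hC x hx m) (hpos x)
  by_contra! hlt
  obtain ⟨m, hm⟩ := exists_nat_gt ((C * ∫ x, e x ∂μ) / (δ * ∫ x, e x ∂μ - ∫ x in A, e x ∂μ))
  rw [div_lt_iff₀ (sub_pos.2 hlt)] at hm
  linarith [hbound m]

theorem setIntegral_norm_comp_sub_le [IsFiniteMeasure μ] (hS : MeasurePreserving S μ μ)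
    {f g : X → E} (hf : Integrable f μ) (hg : Integrable g μ) {A : Set X} (hA : MeasurableSet A)
    {η : ℝ} (hη : ∀ x ∈ A, ‖g (S x) - g x‖ ≤ η) :
    ∫ x in A, ‖f (S x) - f x‖ ∂μ ≤ 2 * ∫ x, ‖f x - g x‖ ∂μ + η * μ.real A := by
  have hfg : Integrable (fun x => ‖f x - g x‖) μ := (hf.sub hg).norm
  have hfgS : Integrable (fun x => ‖f (S x) - g (S x)‖) μ := hS.integrable_comp_of_integrable hfg
  have hsum : Integrable (fun x => ‖f (S x) - g (S x)‖ + ‖f x - g x‖) μ := hfgS.add hfg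
  have hle (x : X) (hx : x ∈ A) :
      ‖f (S x) - f x‖ ≤ ‖f (S x) - g (S x)‖ + ‖f x - g x‖ + η := by
    calc ‖f (S x) - f x‖
        = ‖(f (S x) - g (S x)) + (g x - f x) + (g (S x) - g x)‖ := by congr 1; abel
      _ ≤ ‖f (S x) - g (S x)‖ + ‖g x - f x‖ + ‖g (S x) - g x‖ := norm_add₃_le
      _ ≤ ‖f (S x) - g (S x)‖ + ‖f x - g x‖ + η := by
        rw [norm_sub_rev (g x)]
        exact add_le_add_right (hη x hx) _
  calc ∫ x in A, ‖f (S x) - f x‖ ∂μ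
      ≤ ∫ x in A, (‖f (S x) - g (S x)‖ + ‖f x - g x‖ + η) ∂μ :=
        setIntegral_mono_on ((hS.integrable_comp_of_integrable hf).sub hf).norm.integrableOn
          (hsum.add (integrable_const η)).integrableOn hA hle
    _ = (∫ x in A, (‖f (S x) - g (S x)‖ + ‖f x - g x‖) ∂μ) + η * μ.real A := by
        rw [integral_add hsum.integrableOn (integrable_const η), setIntegral_const,
          smul_eq_mul, mul_comm]
    _ ≤ (∫ x, (‖f (S x) - g (S x)‖ + ‖f x - g x‖) ∂μ) + η * μ.real A := by
        gcongr ?_ + _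
        exact setIntegral_le_integral hsum
          (.of_forall fun _ => add_nonneg (norm_nonneg _) (norm_nonneg _))
    _ = 2 * ∫ x, ‖f x - g x‖ ∂μ + η * μ.real A := by
        rw [integral_add hfgS hfg, integral_comp_of_measurePreserving hS hfg.1, two_mul]

end InvariantIntegrals

variable [MetricSpace X] [ProperSpace X] [MeasurableSpace X] [BorelSpace X] {μ : Measure X}
  [IsFiniteMeasure μ]

theorem tendsto_setIntegral_norm_comp_sub [NormedSpace ℝ E] {S : ℕ → X → X}
    (hS : ∀ l, MeasurePreserving (S l) μ μ) {f : X → E} (hf : Integrable f μ) {A : ℕ → Set X}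
    (hA : ∀ l, MeasurableSet (A l)) {ε : ℕ → ℝ} (hε : Tendsto ε atTop (𝓝 0))
    (hSA : ∀ l, ∀ x ∈ A l, dist (S l x) x ≤ ε l) :
    Tendsto (fun l => ∫ x in A l, ‖f (S l x) - f x‖ ∂μ) atTop (𝓝 0) := by
  refine tendsto_order.2 ⟨fun b hb => .of_forall fun l => hb.trans_le (by positivity),
    fun b hb => ?_⟩
  obtain ⟨η, hη, hηb⟩ := exists_pos_mul_lt hb (2 + μ.real Set.univ)
  obtain ⟨g, hgs, hfg, hgc, hgi⟩ := hf.exists_hasCompactSupport_integral_sub_le hη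
  obtain ⟨r, hr, hgr⟩ := Metric.uniformContinuous_iff.1
    (hgs.uniformContinuous_of_continuous hgc) η hη
  filter_upwards [hε.eventually_lt_const hr] with l hl
  calc ∫ x in A l, ‖f (S l x) - f x‖ ∂μ
      ≤ 2 * ∫ x, ‖f x - g x‖ ∂μ + η * μ.real (A l) :=
        setIntegral_norm_comp_sub_le (hS l) hf hgi (hA l) fun x hx => by
          rw [← dist_eq_norm]
          exact (hgr ((hSA l x hx).trans_lt hl)).le
    _ ≤ 2 * η + η * μ.real Set.univ := by
        gcongr ?_ + η * ?_
        · linarith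
        · exact measureReal_mono (Set.subset_univ _)
    _ < b := by linarith

theorem tendsto_pow_of_measurable_eigenfunction {S : X → X} (hS : MeasurePreserving S μ μ)
    {Y : Set X} (hY : ∀ᵐ x ∂μ, x ∈ Y) {c : ℂ} (hc : ‖c‖ = 1) {f : X → ℂ} (hf : Integrable f μ)
    (hf0 : ¬ f =ᵐ[μ] 0) (hfc : ∀ᵐ x ∂μ, f (S x) = c * f x) {δ : ℝ} (hδ : 0 < δ) {a : ℕ → ℕ}
    {ε : ℕ → ℝ} (hε : Tendsto ε atTop (𝓝 0))
    (hvis : ∀ l, VisitsWithFrequency S Y {x | dist (S^[a l] x) x ≤ ε l} δ) :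
    Tendsto (fun l => c ^ a l) atTop (𝓝 1) := by
  have hA (l : ℕ) : MeasurableSet {x | dist (S^[a l] x) x ≤ ε l} :=
    measurableSet_le ((hS.measurable.iterate _).dist measurable_id) measurable_const
  have hpos : 0 < δ * ∫ x, ‖f x‖ ∂μ := by
    refine mul_pos hδ ((integral_nonneg fun _ => norm_nonneg _).lt_of_ne' fun h0 => hf0 ?_)
    filter_upwards [(integral_eq_zero_iff_of_nonneg (fun _ => norm_nonneg _) hf.norm).1 h0]
      with x hx using norm_eq_zero.1 hx
  have hnorm : ∀ᵐ x ∂μ, ‖f (S x)‖ = ‖f x‖ := by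
    filter_upwards [hfc] with x hx
    rw [hx, norm_mul, hc, one_mul]
  have hle (l : ℕ) : ‖c ^ a l - 1‖ * (δ * ∫ x, ‖f x‖ ∂μ) ≤
      ∫ x in {x | dist (S^[a l] x) x ≤ ε l}, ‖f (S^[a l] x) - f x‖ ∂μ := by
    calc ‖c ^ a l - 1‖ * (δ * ∫ x, ‖f x‖ ∂μ)
        ≤ ‖c ^ a l - 1‖ * ∫ x in {x | dist (S^[a l] x) x ≤ ε l}, ‖f x‖ ∂μ := by
          gcongr
          exact (hvis l).mul_integral_le_setIntegral hY (hA l) hS hf.norm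
            (fun _ => norm_nonneg _) hnorm
      _ = ∫ x in {x | dist (S^[a l] x) x ≤ ε l}, ‖f (S^[a l] x) - f x‖ ∂μ := by
          rw [← integral_const_mul]
          refine integral_congr_ae (ae_restrict_of_ae ?_)
          filter_upwards [ae_comp_iterate_eq_pow_mul hS.quasiMeasurePreserving hfc (a l)] with x hx
          rw [hx, ← norm_mul, sub_mul, one_mul]
  have hlim := (tendsto_setIntegral_norm_comp_sub (fun l => hS.iterate (a l)) hf hA hε
    fun _ _ hx => hx).div_const (δ * ∫ x, ‖f x‖ ∂μ)
  rw [zero_div] at hlim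
  exact tendsto_iff_norm_sub_tendsto_zero.2 <|
    squeeze_zero (fun _ => norm_nonneg _) (fun l => (le_div_iff₀ hpos).2 (hle l)) hlim

end MeasurableEigenfunctions

section ContinuousEigenfunctions

theorem exists_forall_dist_lt_of_eqOn_lt {A M : Type*} [TopologicalSpace A] [DiscreteTopology A]
    [PseudoMetricSpace M] {K : Set (ℕ → A)} (hK : IsCompact K) {φ : (ℕ → A) → M}
    (hφ : ContinuousOn φ K) {ε : ℝ} (hε : 0 < ε) :
    ∃ N, ∀ x ∈ K, ∀ y ∈ K, (∀ t < N, x t = y t) → dist (φ x) (φ y) < ε := by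
  let _ := PiNat.metricSpace (E := fun _ : ℕ => A)
  obtain ⟨r, hr, hφr⟩ :=
    Metric.uniformContinuousOn_iff.1 (hK.uniformContinuousOn_of_continuous hφ) ε hε
  obtain ⟨N, hN⟩ := exists_pow_lt_of_lt_one hr one_half_lt_one
  exact ⟨N, fun x hx y hy hxy => hφr x hx y hy ((PiNat.mem_cylinder_iff_dist_le.1 hxy).trans_lt hN)⟩

theorem iterate_shift_apply (x : ℕ → Fin 3) (n t : ℕ) : shift^[n] x t = x (t + n) := by
  induction n generalizing x with
  | zero => rfl
  | succ n ih =>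
    rw [Function.iterate_succ_apply, ih]
    rfl

variable {w : ℕ → Fin 3} {c : ℂ} {φ : (ℕ → Fin 3) → ℂ}

theorem eigenfunction_iterate_shift {K : Set (ℕ → Fin 3)} (hK : ∀ n, shift^[n] w ∈ K)
    (hc : ∀ x ∈ K, φ (shift x) = c * φ x) (n : ℕ) : φ (shift^[n] w) = c ^ n * φ w := by
  induction n with
  | zero => simp
  | succ n ih => rw [Function.iterate_succ_apply', hc _ (hK n), ih, pow_succ', mul_assoc]

theorem tendsto_pow_of_continuous_eigenfunction (hc : ‖c‖ = 1)
    (hφ : ContinuousOn φ (closure (Set.range fun n : ℕ => shift^[n] w)))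
    (hφ0 : ∃ x ∈ closure (Set.range fun n : ℕ => shift^[n] w), φ x ≠ 0)
    (hφc : ∀ x ∈ closure (Set.range fun n : ℕ => shift^[n] w), φ (shift x) = c * φ x)
    {a : ℕ → ℕ} (ha : ∀ l, ∃ i, ∀ t < l, w (t + (i + a l)) = w (t + i)) :
    Tendsto (fun l => c ^ a l) atTop (𝓝 1) := by
  set K := closure (Set.range fun n : ℕ => shift^[n] w)
  have hmem (n : ℕ) : shift^[n] w ∈ K := subset_closure ⟨n, rfl⟩
  have hpow := eigenfunction_iterate_shift hmem hφc
  have hw : φ w ≠ 0 := fun h0 => by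
    obtain ⟨x, hx, hne⟩ := hφ0
    refine hne (Set.EqOn.of_subset_closure (g := 0) ?_ hφ continuousOn_const subset_closure
      subset_rfl hx)
    rintro _ ⟨n, rfl⟩
    rw [hpow, h0, mul_zero, Pi.zero_apply]
  refine Metric.tendsto_atTop.2 fun ε hε => ?_
  obtain ⟨N, hN⟩ := exists_forall_dist_lt_of_eqOn_lt isClosed_closure.isCompact hφ
    (mul_pos hε (norm_pos_iff.2 hw))
  refine ⟨N, fun l hl => ?_⟩
  obtain ⟨i, hi⟩ := ha l
  have hdist := hN _ (hmem (i + a l)) _ (hmem i) fun t ht => by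
    rw [iterate_shift_apply, iterate_shift_apply, hi t (ht.trans_le hl)]
  have hfactor : c ^ (i + a l) * φ w - c ^ i * φ w = c ^ i * ((c ^ a l - 1) * φ w) := by ring
  rw [hpow, hpow, dist_eq_norm, hfactor, norm_mul, norm_mul, norm_pow, hc, one_pow,
    one_mul] at hdist
  rw [dist_eq_norm]
  exact lt_of_mul_lt_mul_right hdist (norm_nonneg _)

end ContinuousEigenfunctions

/-! ### Expansions -/

/-- The real sequence `x` in `(0, 1)` is an expansion with digit sequence `k`: `x n` is determined
by the digit `k n` and the next two entries. The first coordinates along a `G`-orbit of infinite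
type form such a sequence. -/
structure IsExpansion (k : ℕ → ℕ) (x : ℕ → ℝ) : Prop where
  pos : ∀ n, 0 < x n
  lt_one : ∀ n, x n < 1
  mul_eq_one : ∀ n, x n * (k n + x (n + 1) * (1 - x (n + 2))) = 1

/-- The sup distance of two real sequences on the indices `n` and `n + 1`. -/
noncomputable def gap (x y : ℕ → ℝ) (n : ℕ) : ℝ := max |x n - y n| |x (n + 1) - y (n + 1)|

theorem gap_nonneg (x y : ℕ → ℝ) (n : ℕ) : 0 ≤ gap x y n := (abs_nonneg _).trans (le_max_left _ _)

namespace IsExpansion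

variable {k k' : ℕ → ℕ} {x y : ℕ → ℝ} {n : ℕ}

theorem tail (hx : IsExpansion k x) (m : ℕ) :
    IsExpansion (fun i => k (m + i)) fun i => x (m + i) :=
  ⟨fun _ => hx.pos _, fun _ => hx.lt_one _, fun _ => hx.mul_eq_one _⟩

theorem mul_one_sub_pos (hx : IsExpansion k x) (n : ℕ) : 0 < x n * (1 - x (n + 1)) :=
  mul_pos (hx.pos _) (sub_pos.2 (hx.lt_one _))

theorem digit_mul_lt_one (hx : IsExpansion k x) (n : ℕ) : k n * x n < 1 := by
  have h := mul_pos (hx.pos n) (hx.mul_one_sub_pos (n + 1))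
  linarith [hx.mul_eq_one n]

theorem le_half_of_two_le (hx : IsExpansion k x) (hk : 2 ≤ k n) : x n ≤ 1 / 2 := by
  have hk' : (2 : ℝ) ≤ k n := by exact_mod_cast hk
  nlinarith [hx.digit_mul_lt_one n, hx.pos n]

theorem one_le_digit (hx : IsExpansion k x) (n : ℕ) : 1 ≤ k n := by
  by_contra! hk
  have h := hx.mul_eq_one n
  rw [Nat.lt_one_iff.1 hk, Nat.cast_zero, zero_add] at h
  have hs : x (n + 1) * (1 - x (n + 2)) < 1 :=
    mul_lt_one_of_nonneg_of_lt_one_left (hx.pos _).le (hx.lt_one _) (by linarith [hx.pos (n + 2)])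
  exact (mul_lt_one_of_nonneg_of_lt_one_left (hx.pos n).le (hx.lt_one n) hs.le).ne h

/-- If all digits were `1`, then `1 / (1 - x (2 * m))` would decrease by at least `1` in each
step. -/
theorem exists_two_le_digit (hx : IsExpansion k x) : ∃ n, 2 ≤ k n := by
  by_contra! hk
  have hone (n : ℕ) : 1 - x n = x n * x (n + 1) * (1 - x (n + 2)) := by
    have h := hx.mul_eq_one n
    rw [show k n = 1 by have := hk n; have := hx.one_le_digit n; omega, Nat.cast_one] at h
    linarith
  have hstep (n : ℕ) : 1 / (1 - x (n + 2)) ≤ 1 / (1 - x n) - 1 := by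
    have h0 := sub_pos.2 (hx.lt_one n)
    have h2 := sub_pos.2 (hx.lt_one (n + 2))
    have hle : 1 - x n ≤ x n * (1 - x (n + 2)) := by
      rw [hone n, mul_right_comm]
      exact mul_le_of_le_one_right (mul_pos (hx.pos n) h2).le (hx.lt_one _).le
    rw [div_sub_one h0.ne', sub_sub_cancel, div_le_div_iff₀ h2 h0, one_mul]
    exact hle
  have hdecr (m : ℕ) : 1 / (1 - x (2 * m)) ≤ 1 / (1 - x 0) - m := by
    induction m with
    | zero => simp
    | succ m ih =>
      rw [mul_add_one, Nat.cast_succ]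
      linarith [hstep (2 * m)]
  obtain ⟨m, hm⟩ := exists_nat_gt (1 / (1 - x 0))
  have hpos := one_div_pos.2 (sub_pos.2 (hx.lt_one (2 * m)))
  linarith [hdecr m]

theorem abs_sub_le_mul (hx : IsExpansion k x) (hy : IsExpansion k' y) (hn : k' n = k n) :
    |x n - y n| ≤ x n * y n * ((1 - (x (n + 2) + y (n + 2)) / 2) * |x (n + 1) - y (n + 1)| +
      (x (n + 1) + y (n + 1)) / 2 * |x (n + 2) - y (n + 2)|) := by
  have hyn := hy.mul_eq_one n
  rw [hn] at hyn
  have hsub : x n - y n = x n * y n * (-(1 - (x (n + 2) + y (n + 2)) / 2) *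
      (x (n + 1) - y (n + 1)) + (x (n + 1) + y (n + 1)) / 2 * (x (n + 2) - y (n + 2))) := by
    linear_combination y n * hx.mul_eq_one n - x n * hyn
  have hz : 0 ≤ 1 - (x (n + 2) + y (n + 2)) / 2 := by
    linarith [hx.lt_one (n + 2), hy.lt_one (n + 2)]
  have hw : 0 ≤ (x (n + 1) + y (n + 1)) / 2 := by linarith [hx.pos (n + 1), hy.pos (n + 1)]
  rw [hsub, abs_mul, abs_of_pos (mul_pos (hx.pos n) (hy.pos n))]
  refine mul_le_mul_of_nonneg_left ?_ (mul_pos (hx.pos n) (hy.pos n)).le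
  refine (abs_add_le _ _).trans_eq ?_
  rw [abs_mul, abs_mul, abs_neg, abs_of_nonneg hz, abs_of_nonneg hw]

theorem one_add_le_mul (hx : IsExpansion k x) (hy : IsExpansion k' y) (n : ℕ) :
    1 + x (n + 1) * (1 - x (n + 2)) + y (n + 1) * (1 - y (n + 2)) ≤
      (k n + x (n + 1) * (1 - x (n + 2))) * (k' n + y (n + 1) * (1 - y (n + 2))) := by
  have hk : (1 : ℝ) ≤ k n := by exact_mod_cast hx.one_le_digit n
  have hk' : (1 : ℝ) ≤ k' n := by exact_mod_cast hy.one_le_digit n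
  have hxpos := hx.mul_one_sub_pos (n + 1)
  have hypos := hy.mul_one_sub_pos (n + 1)
  calc 1 + x (n + 1) * (1 - x (n + 2)) + y (n + 1) * (1 - y (n + 2))
      ≤ (1 + x (n + 1) * (1 - x (n + 2))) * (1 + y (n + 1) * (1 - y (n + 2))) := by
        linarith [mul_pos hxpos hypos]
    _ ≤ _ := by gcongr

theorem abs_sub_le_of_weighted_le (hx : IsExpansion k x) (hy : IsExpansion k' y)
    (hn : k' n = k n) {a b C : ℝ} (ha : |x (n + 1) - y (n + 1)| ≤ a)
    (hb : |x (n + 2) - y (n + 2)| ≤ b) (hC : 0 ≤ C)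
    (hW : (1 - (x (n + 2) + y (n + 2)) / 2) * a + (x (n + 1) + y (n + 1)) / 2 * b ≤
      C * (1 + x (n + 1) * (1 - x (n + 2)) + y (n + 1) * (1 - y (n + 2)))) :
    |x n - y n| ≤ C := by
  have hz : 0 ≤ 1 - (x (n + 2) + y (n + 2)) / 2 := by
    linarith [hx.lt_one (n + 2), hy.lt_one (n + 2)]
  have hw : 0 ≤ (x (n + 1) + y (n + 1)) / 2 := by linarith [hx.pos (n + 1), hy.pos (n + 1)]
  have hxy : 0 ≤ x n * y n := (mul_pos (hx.pos n) (hy.pos n)).le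
  calc |x n - y n|
      ≤ x n * y n * ((1 - (x (n + 2) + y (n + 2)) / 2) * |x (n + 1) - y (n + 1)| +
          (x (n + 1) + y (n + 1)) / 2 * |x (n + 2) - y (n + 2)|) := hx.abs_sub_le_mul hy hn
    _ ≤ x n * y n * ((1 - (x (n + 2) + y (n + 2)) / 2) * a + (x (n + 1) + y (n + 1)) / 2 * b) := by
        gcongr
    _ ≤ x n * y n * (C * ((k n + x (n + 1) * (1 - x (n + 2))) *
          (k' n + y (n + 1) * (1 - y (n + 2))))) := by
        gcongr
        exact hW.trans (mul_le_mul_of_nonneg_left (hx.one_add_le_mul hy n) hC)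
    _ = C * (x n * (k n + x (n + 1) * (1 - x (n + 2)))) *
          (y n * (k' n + y (n + 1) * (1 - y (n + 2)))) := by ring
    _ = C := by rw [hx.mul_eq_one, hy.mul_eq_one, mul_one, mul_one]

theorem gap_le_gap_succ (hx : IsExpansion k x) (hy : IsExpansion k' y) (hn : k' n = k n) :
    gap x y n ≤ gap x y (n + 1) := by
  refine max_le (hx.abs_sub_le_of_weighted_le hy hn (a := gap x y (n + 1)) (b := gap x y (n + 1))
    (le_max_left _ _) (le_max_right _ _) (gap_nonneg x y (n + 1)) ?_) (le_max_left _ _)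
  have hxw : x (n + 1) * x (n + 2) ≤ (x (n + 1) + x (n + 2)) / 2 := by
    nlinarith [hx.pos (n + 1), hx.pos (n + 2), hx.lt_one (n + 1), hx.lt_one (n + 2)]
  have hyw : y (n + 1) * y (n + 2) ≤ (y (n + 1) + y (n + 2)) / 2 := by
    nlinarith [hy.pos (n + 1), hy.pos (n + 2), hy.lt_one (n + 1), hy.lt_one (n + 2)]
  rw [← add_mul, mul_comm]
  exact mul_le_mul_of_nonneg_left (by linarith) (gap_nonneg x y (n + 1))

theorem abs_sub_le_half_gap_succ (hx : IsExpansion k x) (hy : IsExpansion k' y)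
    (hn : k' n = k n) (hk : 2 ≤ k n) : |x n - y n| ≤ gap x y (n + 1) / 2 := by
  have hxy : x n * y n ≤ 1 / 2 * (1 / 2) :=
    mul_le_mul (hx.le_half_of_two_le hk) (hy.le_half_of_two_le (hn ▸ hk)) (hy.pos n).le (by simp)
  have hweights : (1 - (x (n + 2) + y (n + 2)) / 2) * |x (n + 1) - y (n + 1)| +
      (x (n + 1) + y (n + 1)) / 2 * |x (n + 2) - y (n + 2)| ≤
      1 * gap x y (n + 1) + 1 * gap x y (n + 1) := by
    gcongr
    · linarith [hx.pos (n + 2), hy.pos (n + 2)]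
    · exact le_max_left _ _
    · linarith [hx.lt_one (n + 1), hy.lt_one (n + 1)]
    · exact le_max_right _ _
  calc |x n - y n| ≤ _ := hx.abs_sub_le_mul hy hn
    _ ≤ x n * y n * (1 * gap x y (n + 1) + 1 * gap x y (n + 1)) :=
        mul_le_mul_of_nonneg_left hweights (mul_pos (hx.pos n) (hy.pos n)).le
    _ ≤ 1 / 2 * (1 / 2) * (1 * gap x y (n + 1) + 1 * gap x y (n + 1)) :=
        mul_le_mul_of_nonneg_right hxy (by linarith [gap_nonneg x y (n + 1)])
    _ = gap x y (n + 1) / 2 := by ring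

theorem gap_le_mul_gap_add_two (hx : IsExpansion k x) (hy : IsExpansion k' y)
    (hn : k' n = k n) (hn' : k' (n + 1) = k (n + 1)) (hk : 2 ≤ k (n + 1)) :
    gap x y n ≤ 3 / 4 * gap x y (n + 2) := by
  have hM := gap_nonneg x y (n + 2)
  have hhalf := hx.abs_sub_le_half_gap_succ hy hn' hk
  refine max_le (hx.abs_sub_le_of_weighted_le hy hn (b := gap x y (n + 2)) hhalf
    (le_max_left _ _) (by linarith) ?_) (by linarith)
  have hxw : x (n + 1) * x (n + 2) ≤ 1 / 2 * x (n + 2) :=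
    mul_le_mul_of_nonneg_right (hx.le_half_of_two_le hk) (hx.pos _).le
  have hyw : y (n + 1) * y (n + 2) ≤ 1 / 2 * y (n + 2) :=
    mul_le_mul_of_nonneg_right (hy.le_half_of_two_le (hn' ▸ hk)) (hy.pos _).le
  calc (1 - (x (n + 2) + y (n + 2)) / 2) * (gap x y (n + 2) / 2) +
        (x (n + 1) + y (n + 1)) / 2 * gap x y (n + 2)
      = ((1 - (x (n + 2) + y (n + 2)) / 2) / 2 + (x (n + 1) + y (n + 1)) / 2) *
          gap x y (n + 2) := by ring
    _ ≤ (3 / 4 * (1 + x (n + 1) * (1 - x (n + 2)) + y (n + 1) * (1 - y (n + 2)))) *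
          gap x y (n + 2) := by
        refine mul_le_mul_of_nonneg_right ?_ hM
        linarith [hx.pos (n + 1), hy.pos (n + 1), hx.lt_one (n + 2), hy.lt_one (n + 2)]
    _ = _ := by ring

theorem gap_zero_le_gap (hx : IsExpansion k x) (hy : IsExpansion k' y)
    (hn : ∀ i < n, k' i = k i) : gap x y 0 ≤ gap x y n := by
  induction n with
  | zero => rfl
  | succ n ih =>
    exact (ih fun i hi => hn i (by omega)).trans (hx.gap_le_gap_succ hy (hn n (by omega)))

theorem gap_zero_le_one (hx : IsExpansion k x) (hy : IsExpansion k' y) : gap x y 0 ≤ 1 := by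
  have hle (n : ℕ) : |x n - y n| ≤ 1 := abs_sub_le_iff.2
    ⟨by linarith [hx.lt_one n, hy.pos n], by linarith [hy.lt_one n, hx.pos n]⟩
  exact max_le (hle 0) (hle 1)

theorem exists_gap_zero_le_pow (r : ℕ) (hx : IsExpansion k x) :
    ∃ n, ∀ k' y, IsExpansion k' y → (∀ i < n, k' i = k i) → gap x y 0 ≤ (3 / 4) ^ r := by
  induction r generalizing k x with
  | zero => exact ⟨0, fun k' y hy _ => by simpa using hx.gap_zero_le_one hy⟩
  | succ r ih =>
    obtain ⟨m, hm⟩ := (hx.tail 1).exists_two_le_digit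
    rw [add_comm] at hm
    obtain ⟨n, hn⟩ := ih (hx.tail (m + 2))
    refine ⟨m + 2 + n, fun k' y hy hk => ?_⟩
    calc gap x y 0 ≤ gap x y m := hx.gap_zero_le_gap hy fun i hi => hk i (by omega)
      _ ≤ 3 / 4 * gap x y (m + 2) :=
          hx.gap_le_mul_gap_add_two hy (hk m (by omega)) (hk (m + 1) (by omega)) hm
      _ ≤ 3 / 4 * (3 / 4) ^ r := by
          gcongr
          exact hn _ _ (hy.tail (m + 2)) fun i hi => hk _ (by omega)
      _ = (3 / 4) ^ (r + 1) := (pow_succ' _ _).symm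

end IsExpansion

/-! ### The parameter space -/

section Parameters

variable {p : ℝ × ℝ}

theorem mem_interior_U : p ∈ interior U ↔ 0 < p.2 ∧ p.2 < p.1 ∧ p.1 < 1 := by
  constructor
  · intro hp
    have htranslate : Tendsto (fun t : ℝ => (p.1 + t, p.2)) (𝓝 0) (𝓝 p) := by
      have hcont : Continuous fun t : ℝ => (p.1 + t, p.2) := by fun_prop
      simpa using hcont.tendsto 0
    obtain ⟨ε, hε, h⟩ := Metric.eventually_nhds_iff.1
      (htranslate.eventually (mem_interior_iff_mem_nhds.1 hp))
    have hright : (p.1 + ε / 2, p.2) ∈ U :=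
      h (by rw [Real.dist_eq, sub_zero, abs_of_pos] <;> linarith)
    have hleft : (p.1 + -(ε / 2), p.2) ∈ U :=
      h (by rw [Real.dist_eq, sub_zero, abs_neg, abs_of_pos] <;> linarith)
    obtain ⟨hpos, -, hlt_one⟩ := hright
    obtain ⟨-, hlt, -⟩ := hleft
    exact ⟨hpos, by linarith, by linarith⟩
  · intro hp
    have hopen : IsOpen {p : ℝ × ℝ | 0 < p.2 ∧ p.2 < p.1 ∧ p.1 < 1} :=
      (isOpen_lt continuous_const continuous_snd).inter <|
        (isOpen_lt continuous_snd continuous_fst).inter (isOpen_lt continuous_fst continuous_const)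
    refine interior_maximal ?_ hopen hp
    exact fun q hq => ⟨hq.1, hq.2.1.le, hq.2.2.le⟩

theorem fst_pos (hp : p ∈ interior U) : 0 < p.1 :=
  (mem_interior_U.1 hp).1.trans (mem_interior_U.1 hp).2.1

theorem fst_mem_Ioc (hp : p ∈ interior U) : p.1 ∈ Set.Ioc 0 1 :=
  ⟨fst_pos hp, (mem_interior_U.1 hp).2.2.le⟩

/-- The integer `⌊1/α⌋` that appears in the renormalization map. -/
noncomputable def digit (p : ℝ × ℝ) : ℕ := ⌊1 / p.1⌋₊

/-- The inverse branch of `G` on the parameters with digit `k`. -/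
noncomputable def branch (k : ℕ) (p : ℝ × ℝ) : ℝ × ℝ :=
  (1 / (k + p.1 - p.2), p.1 / (k + p.1 - p.2))

theorem G_eq (hp : 0 < p.1) : G p = (p.2 / p.1, (p.2 - 1) / p.1 + (digit p : ℝ)) := by
  rw [G, digit, natCast_floor_eq_intCast_floor (by positivity)]

theorem one_le_digit (hp : p ∈ interior U) : 1 ≤ digit p :=
  (Nat.one_le_floor_iff _).2 ((one_le_div (fst_pos hp)).2 (fst_mem_Ioc hp).2)

theorem digit_lt (hp : p ∈ interior U) (hG : G p ∈ interior U) : (digit p : ℝ) < 1 / p.1 := by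
  rw [G_eq (fst_pos hp)] at hG
  have hlt := (mem_interior_U.1 hG).2.1
  simp only [sub_div] at hlt
  linarith

theorem branch_spec {k : ℕ} (hk : 1 ≤ k) (hp : p ∈ interior U) :
    branch k p ∈ interior U ∧ digit (branch k p) = k ∧ G (branch k p) = p := by
  obtain ⟨h0, h1, h2⟩ := mem_interior_U.1 hp
  have hk' : (1 : ℝ) ≤ k := by exact_mod_cast hk
  have hlt : 1 < k + p.1 - p.2 := by linarith
  have hpos : 0 < k + p.1 - p.2 := by linarith
  have hdigit : digit (branch k p) = k := by
    rw [digit, branch, one_div_one_div, Nat.floor_eq_iff hpos.le]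
    constructor <;> linarith
  have hmem : branch k p ∈ interior U := mem_interior_U.2
    ⟨div_pos (h0.trans h1) hpos, div_lt_div_of_pos_right h2 hpos, (div_lt_one hpos).2 hlt⟩
  refine ⟨hmem, hdigit, ?_⟩
  rw [G_eq (fst_pos hmem), hdigit]
  simp only [branch]
  ext
  · field_simp
  · simp only
    field_simp
    ring

theorem iterate_G_mem (hp : p ∈ OmegaInfty) (n : ℕ) : G^[n] p ∈ OmegaInfty := fun m => by
  rw [← Function.iterate_add_apply]
  exact hp _

theorem branch_mem {k : ℕ} (hk : 1 ≤ k) (hp : p ∈ OmegaInfty) : branch k p ∈ OmegaInfty := by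
  obtain ⟨hmem, -, hG⟩ := branch_spec (p := p) hk (hp 0)
  rintro (_ | n)
  · exact hmem
  · rw [Function.iterate_succ_apply, hG]
    exact hp n

theorem eventually_digit_eq (hp : p ∈ interior U) (hG : G p ∈ interior U) :
    ∀ᶠ q in 𝓝 p, digit q = digit p := by
  have hcont : ContinuousAt (fun q : ℝ × ℝ => 1 / q.1) p :=
    continuousAt_const.div continuousAt_fst (fst_pos hp).ne'
  filter_upwards [hcont.eventually (lt_mem_nhds (digit_lt hp hG)),
    hcont.eventually (gt_mem_nhds (Nat.lt_floor_add_one (1 / p.1)))] with q hlt hgt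
  exact (Nat.floor_eq_iff ((Nat.cast_nonneg _).trans hlt.le)).2 ⟨hlt.le, hgt⟩

theorem continuousAt_G (hp : p ∈ interior U) (hG : G p ∈ interior U) : ContinuousAt G p := by
  have hne : p.1 ≠ 0 := (fst_pos hp).ne'
  have hcont : ContinuousAt (fun q : ℝ × ℝ => (q.2 / q.1, (q.2 - 1) / q.1 + (digit p : ℝ))) p := by
    fun_prop (disch := exact hne)
  refine hcont.congr ?_
  filter_upwards [eventually_digit_eq hp hG,
    continuousAt_fst.eventually (lt_mem_nhds (fst_pos hp))] with q hq hpos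
  rw [G_eq hpos, hq]

theorem continuousAt_iterate_G (n : ℕ) (hp : ∀ i ≤ n, G^[i] p ∈ interior U) :
    ContinuousAt (G^[n]) p := by
  induction n with
  | zero => exact continuousAt_id
  | succ n ih =>
    rw [Function.iterate_succ']
    refine ContinuousAt.comp (continuousAt_G (hp n (by omega)) ?_) (ih fun i hi => hp i (by omega))
    rw [← Function.iterate_succ_apply' G]
    exact hp _ le_rfl

theorem isOpen_setOf_iterate_mem (n : ℕ) : IsOpen {p : ℝ × ℝ | ∀ i ≤ n, G^[i] p ∈ interior U} := by
  refine isOpen_iff_mem_nhds.2 fun p hp => ?_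
  have hevent : ∀ i ∈ Set.Iic n, ∀ᶠ q in 𝓝 p, G^[i] q ∈ interior U := fun i hi =>
    (continuousAt_iterate_G i fun j hj => hp j (hj.trans hi)).eventually
      (isOpen_interior.mem_nhds (hp i hi))
  exact (eventually_all_finite (Set.finite_Iic n)).2 hevent

theorem isGδ_OmegaInfty : IsGδ OmegaInfty := by
  have hinter : OmegaInfty = ⋂ n : ℕ, {p : ℝ × ℝ | ∀ i ≤ n, G^[i] p ∈ interior U} := by
    ext p
    simp only [OmegaInfty, Set.mem_ofPred_eq, Set.mem_iInter]
    exact ⟨fun h n i _ => h i, fun h n => h n n le_rfl⟩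
  rw [hinter]
  exact IsGδ.iInter_of_isOpen isOpen_setOf_iterate_mem

/-- The sequence of digits of a parameter along its `G`-orbit. -/
noncomputable def digits (p : ℝ × ℝ) (i : ℕ) : ℕ := digit (G^[i] p)

theorem digits_iterate (p : ℝ × ℝ) (n : ℕ) : digits (G^[n] p) = fun i => digits p (n + i) := by
  funext i
  rw [digits, digits, ← Function.iterate_add_apply, add_comm]

theorem eventually_digits_eq (hp : p ∈ OmegaInfty) (n : ℕ) :
    ∀ᶠ q in 𝓝 p, ∀ i < n, digits q i = digits p i := by
  refine (eventually_all_finite (Set.finite_Iio n)).2 fun i _ => ?_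
  refine (continuousAt_iterate_G i fun j _ => hp j).eventually (eventually_digit_eq (hp i) ?_)
  rw [← Function.iterate_succ_apply' G]
  exact hp _

theorem exists_digits_eq (hp : p ∈ OmegaInfty) {e : ℕ → ℕ} (he : ∀ i, 1 ≤ e i) (n : ℕ) :
    ∃ q ∈ OmegaInfty, ∀ i < n, digits q i = e i := by
  induction n generalizing e with
  | zero => exact ⟨p, hp, by simp⟩
  | succ n ih =>
    obtain ⟨q, hq, hdigits⟩ := ih fun i => he (i + 1)
    obtain ⟨-, hdigit, hG⟩ := branch_spec (p := q) (he 0) (hq 0)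
    refine ⟨branch (e 0) q, branch_mem (he 0) hq, ?_⟩
    rintro (_ | i) hi
    · exact hdigit
    · rw [digits, Function.iterate_succ_apply, hG]
      exact hdigits i (by omega)

theorem snd_eq (hp : p ∈ interior U) : p.2 = p.1 * (G p).1 := by
  rw [G, mul_div_cancel₀ _ (fst_pos hp).ne']

theorem fst_mul_eq_one (hp : p ∈ interior U) (hG : G p ∈ interior U) :
    p.1 * (digit p + (G p).1 * (1 - (G (G p)).1)) = 1 := by
  have hpos := fst_pos hp
  rw [mul_one_sub, ← snd_eq hG, G_eq hpos]
  simp only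
  field_simp
  ring

theorem isExpansion_digits (hp : p ∈ OmegaInfty) :
    IsExpansion (digits p) fun n => (G^[n] p).1 where
  pos n := fst_pos (hp n)
  lt_one n := (mem_interior_U.1 (hp n)).2.2
  mul_eq_one n := by
    simp only [Function.iterate_succ_apply']
    refine fst_mul_eq_one (hp n) ?_
    rw [← Function.iterate_succ_apply' G]
    exact hp _

theorem dist_le_two_mul_gap {q : ℝ × ℝ} (hp : p ∈ interior U) (hq : q ∈ interior U)
    (hGp : G p ∈ interior U) :
    dist q p ≤ 2 * gap (fun n => (G^[n] p).1) (fun n => (G^[n] q).1) 0 := by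
  obtain ⟨-, -, hGp1⟩ := mem_interior_U.1 hGp
  obtain ⟨-, -, hq1⟩ := mem_interior_U.1 hq
  have hfst : |p.1 - q.1| ≤ gap (fun n => (G^[n] p).1) (fun n => (G^[n] q).1) 0 := le_max_left _ _
  have hG : |(G p).1 - (G q).1| ≤ gap (fun n => (G^[n] p).1) (fun n => (G^[n] q).1) 0 :=
    le_max_right _ _
  rw [dist_comm, Prod.dist_eq, Real.dist_eq, Real.dist_eq]
  refine max_le (by linarith [abs_nonneg (p.1 - q.1)]) ?_
  calc |p.2 - q.2| = |(p.1 - q.1) * (G p).1 + q.1 * ((G p).1 - (G q).1)| := by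
        rw [snd_eq hp, snd_eq hq]
        ring_nf
    _ ≤ |p.1 - q.1| * (G p).1 + q.1 * |(G p).1 - (G q).1| := by
        refine (abs_add_le _ _).trans_eq ?_
        rw [abs_mul, abs_mul, abs_of_pos (fst_pos hGp), abs_of_pos (fst_pos hq)]
    _ ≤ |p.1 - q.1| * 1 + 1 * |(G p).1 - (G q).1| := by gcongr
    _ ≤ _ := by linarith

theorem exists_dist_lt_of_digits_eq (hp : p ∈ OmegaInfty) {ε : ℝ} (hε : 0 < ε) :
    ∃ n, ∀ q ∈ OmegaInfty, (∀ i < n, digits q i = digits p i) → dist q p < ε := by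
  obtain ⟨r, hr⟩ := exists_pow_lt_of_lt_one (half_pos hε) (show (3 / 4 : ℝ) < 1 by norm_num)
  obtain ⟨n, hn⟩ := (isExpansion_digits hp).exists_gap_zero_le_pow r
  refine ⟨n, fun q hq hd => ?_⟩
  linarith [dist_le_two_mul_gap (p := p) (q := q) (hp 0) (hq 0) (hp 1),
    hn _ _ (isExpansion_digits hq) hd]

end Parameters

/-! ### Renormalization of itineraries -/

section Reads

variable {p : ℝ × ℝ} {u w : List (Fin 3)} {x x' y z z' : ℝ}

/-- The translation length of `T_{α,β}` on the partition element with the given symbol. -/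
def translation (p : ℝ × ℝ) : Fin 3 → ℝ := ![p.1, p.2, p.2 - 1]

theorem T_eq (p : ℝ × ℝ) (x : ℝ) : T p x = x + translation p (symbol p x) := by
  unfold T symbol translation
  split_ifs <;> simp
  ring

theorem mapsTo_T (hp : p ∈ interior U) : Set.MapsTo (T p) (Set.Icc 0 1) (Set.Icc 0 1) := by
  obtain ⟨h0, h1, h2⟩ := mem_interior_U.1 hp
  rintro x ⟨hx0, hx1⟩
  unfold T
  split_ifs <;> constructor <;> linarith

/-- `Reads p x u z` says that the itinerary of `x` under `T_{α,β}` starts with the word `u`, and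
that reading `u` leads from `x` to `z`. -/
def Reads (p : ℝ × ℝ) : ℝ → List (Fin 3) → ℝ → Prop
  | x, [], z => z = x
  | x, s :: u, z => symbol p x = s ∧ Reads p (T p x) u z

theorem reads_singleton (p : ℝ × ℝ) (x : ℝ) : Reads p x [symbol p x] (T p x) := ⟨rfl, rfl⟩

theorem reads_append : Reads p x (u ++ w) z ↔ ∃ y, Reads p x u y ∧ Reads p y w z := by
  induction u generalizing x with
  | nil => simp [Reads]
  | cons s u ih => simp [Reads, ih, and_assoc]

theorem Reads.iterate_eq (h : Reads p x u z) : (T p)^[u.length] x = z := by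
  induction u generalizing x with
  | nil => exact h.symm
  | cons s u ih => exact ih h.2

theorem Reads.mem_Icc (h : Reads p x u z) (hp : p ∈ interior U) (hx : x ∈ Set.Icc 0 1) :
    z ∈ Set.Icc 0 1 :=
  h.iterate_eq ▸ (mapsTo_T hp).iterate _ hx

theorem Reads.iterate_sub_iterate (h : Reads p x u z) (h' : Reads p x' u z') {t : ℕ}
    (ht : t ≤ u.length) : (T p)^[t] x' - (T p)^[t] x = x' - x := by
  induction u generalizing x x' t with
  | nil => rw [Nat.le_zero.1 ht, Function.iterate_zero, id, id]
  | cons s u ih =>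
    cases t with
    | zero => rfl
    | succ t =>
      rw [Function.iterate_succ_apply, Function.iterate_succ_apply,
        ih h.2 h'.2 (Nat.le_of_succ_le_succ ht), T_eq, T_eq, h.1, h'.1]
      ring

theorem Reads.symbol_iterate_eq (h : Reads p x u z) (h' : Reads p x' u z') {t : ℕ}
    (ht : t < u.length) : symbol p ((T p)^[t] x) = symbol p ((T p)^[t] x') := by
  induction u generalizing x x' t with
  | nil => exact absurd ht (Nat.not_lt_zero t)
  | cons s u ih =>
    cases t with
    | zero => exact h.1.trans h'.1.symm
    | succ t => exact ih h.2 h'.2 (Nat.lt_of_succ_lt_succ ht)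

theorem Reads.replicate_eq {s : Fin 3} {j : ℕ} (h : Reads p x (List.replicate j s) z) :
    z = x + j * translation p s := by
  induction j generalizing x with
  | zero => simpa [Reads] using h
  | succ j ih =>
    rw [ih h.2, T_eq, h.1]
    push_cast
    ring

theorem reads_replicate_zero (hp : 0 ≤ p.1) (j : ℕ) (h : x + j * p.1 < 1) :
    Reads p x (List.replicate j 0) (x + j * p.1) := by
  induction j generalizing x with
  | zero => simp [Reads]
  | succ j ih =>
    push_cast at h
    have hx : x < 1 - p.1 := by linarith [mul_nonneg (Nat.cast_nonneg (α := ℝ) j) hp]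
    have hT : T p x = x + p.1 := if_pos hx
    refine ⟨if_pos hx, ?_⟩
    rw [hT]
    convert ih (x := x + p.1) (by linarith) using 1
    push_cast
    ring

theorem reads_two_cons_replicate_zero (hp : p ∈ interior U) (hx : 1 - p.2 ≤ x) (j : ℕ)
    (h : x - 1 + p.2 + j * p.1 < 1) :
    Reads p x (2 :: List.replicate j 0) (x - 1 + p.2 + j * p.1) := by
  have hlow : ¬ x < 1 - p.1 := by linarith [(mem_interior_U.1 hp).2.1]
  have hT : T p x = x - 1 + p.2 := by rw [T, if_neg hlow, if_neg hx.not_gt]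
  refine ⟨by rw [symbol, if_neg hlow, if_neg hx.not_gt], ?_⟩
  rw [hT]
  exact reads_replicate_zero (fst_pos hp).le j h

/-- The words read by the first return map of `T_{α,β}` to `[1 - α, 1]`, if `α` has digit `k`. -/
def letterWord (k : ℕ) : Fin 3 → List (Fin 3) :=
  ![[1], 2 :: List.replicate k 0, 2 :: List.replicate (k - 1) 0]

/-- The substitution attached to the digit `k`. -/
def subst (k : ℕ) (u : List (Fin 3)) : List (Fin 3) := u.flatMap (letterWord k)

theorem subst_append (k : ℕ) (u w : List (Fin 3)) :
    subst k (u ++ w) = subst k u ++ subst k w := List.flatMap_append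

/-- The affine map of `[0, 1]` onto `[1 - l, 1]` that fixes `1`. It conjugates `T_{G(α,β)}` to the
first return map of `T_{α,β}` to `[1 - α, 1]` if `l = α`. -/
def zoom (l y : ℝ) : ℝ := 1 - l * (1 - y)

theorem zoom_one_left (y : ℝ) : zoom 1 y = y := by rw [zoom, one_mul, sub_sub_cancel]

theorem zoom_mul (l l' y : ℝ) : zoom (l * l') y = zoom l (zoom l' y) := by
  unfold zoom
  ring

theorem image_zoom {l : ℝ} (hl : 0 < l) : zoom l '' Set.Icc 0 1 = Set.Icc (1 - l) 1 := by
  have hcomp : zoom l = (fun y => l * y + (1 - l)) := by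
    funext y
    unfold zoom
    ring
  rw [hcomp, Set.image_affine_Icc' hl]
  simp

theorem zoom_mem_Icc {l : ℝ} (hl : l ∈ Set.Ioc 0 1) (hy : y ∈ Set.Icc 0 1) :
    zoom l y ∈ Set.Icc 0 1 :=
  Set.Icc_subset_Icc_left (sub_nonneg.2 hl.2) (image_zoom hl.1 ▸ Set.mem_image_of_mem _ hy)

theorem reads_zoom_two_cons (hp : p ∈ interior U) (hy : 1 - (G p).1 ≤ y) (hz : z < 1) {j : ℕ}
    (h : zoom p.1 z = zoom p.1 y - 1 + p.2 + j * p.1) :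
    Reads p (zoom p.1 y) (2 :: List.replicate j 0) (zoom p.1 z) := by
  have hpos := fst_pos hp
  have hlow : 1 - p.2 ≤ zoom p.1 y := by
    rw [snd_eq hp]
    unfold zoom
    linarith [mul_le_mul_of_nonneg_left hy hpos.le]
  have hlt_one : zoom p.1 z < 1 := by
    unfold zoom
    linarith [mul_pos hpos (sub_pos.2 hz)]
  rw [h] at hlt_one ⊢
  exact reads_two_cons_replicate_zero hp hlow j hlt_one

theorem reads_zoom_letterWord (hp : p ∈ interior U) (hG : G p ∈ interior U)
    (hy : y ∈ Set.Icc 0 1) :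
    Reads p (zoom p.1 y) (letterWord (digit p) (symbol (G p) y)) (zoom p.1 (T (G p) y)) := by
  have hpos := fst_pos hp
  have hfst : p.1 * (G p).1 = p.2 := (snd_eq hp).symm
  have hsnd : p.1 * (G p).2 = p.2 - 1 + digit p * p.1 := by
    rw [G_eq hpos]
    field_simp
  by_cases hlow : y < 1 - (G p).1
  · have hlow' : ¬ zoom p.1 y < 1 - p.1 := by
      unfold zoom
      linarith [mul_nonneg hpos.le hy.1]
    have hmid' : zoom p.1 y < 1 - p.2 := by
      unfold zoom
      linarith [mul_lt_mul_of_pos_left hlow hpos]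
    rw [symbol, T, if_pos hlow, if_pos hlow]
    refine ⟨by rw [symbol, if_neg hlow', if_pos hmid'], ?_⟩
    simp only [Reads, T, if_neg hlow', if_pos hmid']
    unfold zoom
    linarith
  by_cases hmid : y < 1 - (G p).2
  · rw [symbol, T, if_neg hlow, if_neg hlow, if_pos hmid, if_pos hmid]
    refine reads_zoom_two_cons hp (not_lt.1 hlow) (by linarith) ?_
    unfold zoom
    linarith
  · obtain ⟨-, hsnd_lt, hfst_lt⟩ := mem_interior_U.1 hG
    rw [symbol, T, if_neg hlow, if_neg hlow, if_neg hmid, if_neg hmid]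
    refine reads_zoom_two_cons hp (not_lt.1 hlow) (by linarith [hy.2]) ?_
    rw [Nat.cast_sub (one_le_digit hp)]
    unfold zoom
    push_cast
    linarith

theorem Reads.zoom_subst (h : Reads (G p) y u z) (hp : p ∈ interior U) (hG : G p ∈ interior U)
    (hy : y ∈ Set.Icc 0 1) :
    Reads p (zoom p.1 y) (subst (digit p) u) (zoom p.1 z) := by
  induction u generalizing y with
  | nil => exact congrArg (zoom p.1) h
  | cons s u ih =>
    rw [subst, List.flatMap_cons, reads_append]
    refine ⟨_, ?_, ih h.2 (mapsTo_T hG hy)⟩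
    rw [← h.1]
    exact reads_zoom_letterWord hp hG hy

end Reads

/-- The composition of the first `n` substitutions of a digit sequence. -/
def iterSubst (d : ℕ → ℕ) : ℕ → List (Fin 3) → List (Fin 3)
  | 0, u => u
  | n + 1, u => iterSubst d n (subst (d n) u)

theorem iterSubst_append (d : ℕ → ℕ) (n : ℕ) (u w : List (Fin 3)) :
    iterSubst d n (u ++ w) = iterSubst d n u ++ iterSubst d n w := by
  induction n generalizing u w with
  | zero => rfl
  | succ n ih => simp only [iterSubst, subst_append, ih]

theorem iterSubst_nil (d : ℕ → ℕ) (n : ℕ) : iterSubst d n [] = [] := by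
  induction n with
  | zero => rfl
  | succ _ ih => exact ih

theorem iterSubst_add (d : ℕ → ℕ) (n k : ℕ) (u : List (Fin 3)) :
    iterSubst d (n + k) u = iterSubst d n (iterSubst (fun i => d (n + i)) k u) := by
  induction k generalizing u with
  | zero => rfl
  | succ k ih => exact ih _

theorem iterSubst_congr {d e : ℕ → ℕ} {n : ℕ} (h : ∀ i < n, d i = e i) (u : List (Fin 3)) :
    iterSubst d n u = iterSubst e n u := by
  induction n generalizing u with
  | zero => rfl
  | succ n ih =>
    rw [iterSubst, iterSubst, h n n.lt_succ_self]
    exact ih (fun i hi => h i (Nat.lt_succ_of_lt hi)) _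

/-- The length of the word that the `n`-th induced map reads on a letter: a return time. -/
def height (d : ℕ → ℕ) (n : ℕ) (s : Fin 3) : ℕ := (iterSubst d n [s]).length

theorem height_congr {d e : ℕ → ℕ} {n : ℕ} (h : ∀ i < n, d i = e i) (s : Fin 3) :
    height d n s = height e n s := by
  rw [height, iterSubst_congr h, height]

theorem length_iterSubst (d : ℕ → ℕ) (n : ℕ) (u : List (Fin 3)) :
    (iterSubst d n u).length = (u.map (height d n)).sum := by
  induction u with
  | nil => rw [iterSubst_nil]; rfl
  | cons s u ih =>
    rw [← List.singleton_append, iterSubst_append, List.length_append, ih]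
    rfl

theorem length_iterSubst_replicate (d : ℕ → ℕ) (n j : ℕ) (s : Fin 3) :
    (iterSubst d n (List.replicate j s)).length = j * height d n s := by
  rw [length_iterSubst, List.map_replicate, List.sum_replicate, smul_eq_mul]

theorem height_succ (d : ℕ → ℕ) (n : ℕ) (s : Fin 3) :
    height d (n + 1) s = ((letterWord (d n) s).map (height d n)).sum := by
  rw [height, iterSubst, length_iterSubst, subst, List.flatMap_singleton]

theorem height_succ_zero (d : ℕ → ℕ) (n : ℕ) : height d (n + 1) 0 = height d n 1 := rfl

theorem height_succ_one (d : ℕ → ℕ) (n : ℕ) :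
    height d (n + 1) 1 = height d n 2 + d n * height d n 0 := by
  simp [height_succ, letterWord]

theorem height_succ_two (d : ℕ → ℕ) (n : ℕ) :
    height d (n + 1) 2 = height d n 2 + (d n - 1) * height d n 0 := by
  simp [height_succ, letterWord]

theorem height_pos (d : ℕ → ℕ) (n : ℕ) (s : Fin 3) : 0 < height d n s := by
  induction n generalizing s with
  | zero => exact Nat.one_pos
  | succ n ih =>
    fin_cases s
    · exact ih 1
    · exact (height_succ_one d n).symm ▸ Nat.add_pos_left (ih 2) _
    · exact (height_succ_two d n).symm ▸ Nat.add_pos_left (ih 2) _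

theorem coprime_height_gcd_height {d : ℕ → ℕ} (hd : ∀ i, 1 ≤ d i) (n : ℕ) :
    (height d n 1).Coprime ((height d n 0).gcd (height d n 2)) := by
  induction n with
  | zero => exact Nat.gcd_one_left _
  | succ n ih =>
    obtain ⟨k, hk⟩ := Nat.exists_eq_add_of_le' (hd n)
    rw [height_succ_zero, height_succ_one, height_succ_two, hk, Nat.add_sub_cancel, add_one_mul,
      ← add_assoc]
    set g := (height d n 2 + k * height d n 0 + height d n 0).gcd
      ((height d n 1).gcd (height d n 2 + k * height d n 0))
    have hsum : g ∣ height d n 2 + k * height d n 0 :=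
      (Nat.gcd_dvd_right _ _).trans (Nat.gcd_dvd_right _ _)
    have hone : g ∣ height d n 1 := (Nat.gcd_dvd_right _ _).trans (Nat.gcd_dvd_left _ _)
    have hzero : g ∣ height d n 0 := (Nat.dvd_add_right hsum).1 (Nat.gcd_dvd_left _ _)
    have htwo : g ∣ height d n 2 := (Nat.dvd_add_left (hzero.mul_left k)).1 hsum
    exact Nat.eq_one_of_dvd_coprimes ih hone (Nat.dvd_gcd hzero htwo)

/-- The length of the domain of the `n`-th induced map. -/
noncomputable def scale (p : ℝ × ℝ) (n : ℕ) : ℝ := ∏ i ∈ Finset.range n, (G^[i] p).1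

section Scale

variable {p : ℝ × ℝ} {y z : ℝ}

theorem scale_succ (p : ℝ × ℝ) (n : ℕ) : scale p (n + 1) = scale p n * (G^[n] p).1 :=
  Finset.prod_range_succ _ _

theorem scale_add (p : ℝ × ℝ) (n k : ℕ) : scale p (n + k) = scale p n * scale (G^[n] p) k := by
  rw [scale, Finset.prod_range_add]
  simp only [add_comm n, Function.iterate_add_apply]
  rfl

theorem scale_mem_Ioc (hp : p ∈ OmegaInfty) (n : ℕ) : scale p n ∈ Set.Ioc 0 1 :=
  ⟨Finset.prod_pos fun i _ => fst_pos (hp i),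
    Finset.prod_le_one (fun i _ => (fst_pos (hp i)).le) fun i _ => (fst_mem_Ioc (hp i)).2⟩

theorem Reads.zoom_iterSubst {n : ℕ} {u : List (Fin 3)} (h : Reads (G^[n] p) y u z)
    (hp : p ∈ OmegaInfty) (hy : y ∈ Set.Icc 0 1) :
    Reads p (zoom (scale p n) y) (iterSubst (digits p) n u) (zoom (scale p n) z) := by
  induction n generalizing u y z with
  | zero => simpa [zoom_one_left, scale, iterSubst] using h
  | succ n ih =>
    have hG := hp (n + 1)
    rw [Function.iterate_succ_apply'] at h hG
    rw [scale_succ, zoom_mul, zoom_mul]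
    exact ih (h.zoom_subst (hp n) hG hy) (zoom_mem_Icc (fst_mem_Ioc (hp n)) hy)

theorem exists_reads_replicate_zero (hp : p ∈ interior U) (hy : y ∈ Set.Icc 0 1) :
    ∃ j ≤ ⌈1 / p.1⌉₊, ∃ z ∈ zoom p.1 '' Set.Icc 0 1, Reads p y (List.replicate j 0) z := by
  have hpos := fst_pos hp
  rw [image_zoom hpos]
  by_cases hlow : y < 1 - p.1
  · have hquot : 0 < (1 - p.1 - y) / p.1 := div_pos (by linarith) hpos
    have hle := Nat.le_ceil ((1 - p.1 - y) / p.1)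
    have hlt := Nat.ceil_lt_add_one hquot.le
    rw [div_le_iff₀ hpos] at hle
    rw [← sub_lt_iff_lt_add, lt_div_iff₀ hpos] at hlt
    refine ⟨_, Nat.ceil_mono ?_, _, ⟨by linarith, by linarith⟩,
      reads_replicate_zero hpos.le ⌈(1 - p.1 - y) / p.1⌉₊ (by linarith)⟩
    gcongr
    linarith [hy.1]
  · exact ⟨0, Nat.zero_le _, y, ⟨not_lt.1 hlow, hy.2⟩, rfl⟩

theorem exists_iterate_mem_image_zoom (hp : p ∈ OmegaInfty) (n : ℕ) :
    ∃ R : ℕ, ∀ x ∈ Set.Icc (0 : ℝ) 1, ∃ t ≤ R,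
      (T p)^[t] x ∈ zoom (scale p n) '' Set.Icc 0 1 := by
  induction n with
  | zero => exact ⟨0, fun x hx => ⟨0, le_rfl, x, hx, zoom_one_left x⟩⟩
  | succ n ih =>
    obtain ⟨R, hR⟩ := ih
    refine ⟨⌈1 / (G^[n] p).1⌉₊ * height (digits p) n 0 + R, fun x hx => ?_⟩
    obtain ⟨t, ht, y, hy, hxy⟩ := hR x hx
    obtain ⟨j, hj, _, ⟨z, hz, rfl⟩, hreads⟩ := exists_reads_replicate_zero (hp n) hy
    refine ⟨j * height (digits p) n 0 + t, by gcongr, z, hz, ?_⟩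
    rw [Function.iterate_add_apply, ← hxy, ← length_iterSubst_replicate,
      (hreads.zoom_iterSubst hp hy).iterate_eq, scale_succ, zoom_mul]

end Scale

/-! ### Almost periods -/

/-- The points whose `T_{α,β}`-orbit almost repeats itself after time `a`, both in `[0, 1]` and in
its coding; the precision improves with `M`. -/
def recurrenceSet (p : ℝ × ℝ) (a M : ℕ) : Set ℝ :=
  {x | |(T p)^[a] x - x| ≤ 1 / (M + 1) ∧
    ∀ t < M, symbol p ((T p)^[t] x) = symbol p ((T p)^[t] ((T p)^[a] x))}

section Recurrence

variable {p : ℝ × ℝ} {y z : ℝ} {b : Fin 3} {a j k M n r : ℕ}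

theorem recurrenceSet_anti (p : ℝ × ℝ) (a : ℕ) : Antitone (recurrenceSet p a) := by
  rintro M M' hM x ⟨hdist, hsymbol⟩
  exact ⟨hdist.trans (by gcongr), fun t ht => hsymbol t (ht.trans_le hM)⟩

theorem Reads.iterate_mem_recurrenceSet {x x' z' : ℝ} {u : List (Fin 3)} {t : ℕ}
    (h : Reads p x u z) (h' : Reads p x' u z') (ha : (T p)^[a] x = x')
    (hdist : |x' - x| ≤ 1 / (M + 1)) (ht : t + M ≤ u.length) :
    (T p)^[t] x ∈ recurrenceSet p a M := by
  have hcomm : (T p)^[a] ((T p)^[t] x) = (T p)^[t] x' := by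
    rw [← Function.iterate_add_apply, add_comm, Function.iterate_add_apply, ha]
  refine ⟨?_, fun i hi => ?_⟩
  · rwa [hcomm, h.iterate_sub_iterate h' (by omega)]
  · rw [hcomm, ← Function.iterate_add_apply, ← Function.iterate_add_apply]
    exact h.symbol_iterate_eq h' (by omega)

theorem iterate_zoom_mem_recurrenceSet (hp : p ∈ OmegaInfty) (hy : y ∈ Set.Icc 0 1)
    (h : Reads (G^[n] p) y (List.replicate (j + r) b) z)
    (hdisp : |j * translation (G^[n] p) b| ≤ 1 / (M + 1)) {t : ℕ}
    (ht : t + M ≤ r * height (digits p) n b) :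
    (T p)^[t] (zoom (scale p n) y) ∈ recurrenceSet p (j * height (digits p) n b) M := by
  obtain ⟨_, hread, -⟩ : ∃ z', Reads (G^[n] p) y (List.replicate r b) z' ∧
      Reads (G^[n] p) z' (List.replicate j b) z := by
    rwa [← reads_append, ← List.replicate_add, add_comm]
  rw [List.replicate_add, reads_append] at h
  obtain ⟨y', hshift, hread'⟩ := h
  have hiter := (hshift.zoom_iterSubst hp hy).iterate_eq
  rw [length_iterSubst_replicate] at hiter
  have hdist : |zoom (scale p n) y' - zoom (scale p n) y| ≤ 1 / (M + 1) := by
    have hsub : zoom (scale p n) y' - zoom (scale p n) y =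
        scale p n * (j * translation (G^[n] p) b) := by
      unfold zoom
      linear_combination scale p n * hshift.replicate_eq
    obtain ⟨hpos, hle⟩ := scale_mem_Ioc hp n
    rw [hsub, abs_mul, abs_of_pos hpos]
    exact (mul_le_of_le_one_left (abs_nonneg _) hle).trans hdisp
  refine (hread.zoom_iterSubst hp hy).iterate_mem_recurrenceSet
    (hread'.zoom_iterSubst hp (hshift.mem_Icc (hp n) hy)) hiter hdist ?_
  rwa [length_iterSubst_replicate]

theorem sub_le_birkhoffSum_recurrenceSet (hp : p ∈ OmegaInfty) (hy : y ∈ Set.Icc 0 1)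
    (hblock : List.replicate (j + r) b <:+:
      iterSubst (digits (G^[n] p)) k [symbol (G^[n + k] p) y])
    (hdisp : |j * translation (G^[n] p) b| ≤ 1 / (M + 1)) :
    (r * height (digits p) n b - M : ℝ) ≤
      birkhoffSum (T p) ((recurrenceSet p (j * height (digits p) n b) M).indicator 1)
        (height (digits p) (n + k) (symbol (G^[n + k] p) y)) (zoom (scale p (n + k)) y) := by
  obtain ⟨u, w, huw⟩ := hblock
  have hlength : height (digits p) (n + k) (symbol (G^[n + k] p) y) =
      (iterSubst (digits p) n u).length + (j + r) * height (digits p) n b +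
        (iterSubst (digits p) n w).length := by
    rw [height, iterSubst_add, ← digits_iterate, ← huw, iterSubst_append, iterSubst_append,
      List.length_append, List.length_append, length_iterSubst_replicate]
  have hlevel : G^[n + k] p = G^[k] (G^[n] p) := by rw [add_comm, Function.iterate_add_apply]
  have hmem : zoom (scale (G^[n] p) k) y ∈ Set.Icc 0 1 :=
    zoom_mem_Icc (scale_mem_Ioc (iterate_G_mem hp n) k) hy
  have hread := (reads_singleton (G^[k] (G^[n] p)) y).zoom_iterSubst (iterate_G_mem hp n) hy
  rw [← hlevel, ← huw, reads_append] at hread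
  obtain ⟨_, hread, -⟩ := hread
  obtain ⟨x, hprefix, hrep⟩ := reads_append.1 hread
  have hstart := (hprefix.zoom_iterSubst hp hmem).iterate_eq
  rw [← zoom_mul, ← scale_add] at hstart
  have hvisits := natCast_le_birkhoffSum_indicator (f := T p)
    (A := recurrenceSet p (j * height (digits p) n b) M) (m := r * height (digits p) n b - M)
    (n := height (digits p) (n + k) (symbol (G^[n + k] p) y)) (x := zoom (scale p (n + k)) y)
    (a := (iterSubst (digits p) n u).length) (by rw [hlength, add_mul]; omega) fun t ht => by
      rw [add_comm, Function.iterate_add_apply, hstart]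
      exact iterate_zoom_mem_recurrenceSet hp (hprefix.mem_Icc (hp n) hmem) hrep hdisp (by omega)
  refine le_trans ?_ hvisits
  rw [sub_le_iff_le_add]
  exact_mod_cast le_tsub_add

theorem visitsWithFrequency_recurrenceSet (hp : p ∈ OmegaInfty)
    (hblock : ∀ s, List.replicate (j + r) b <:+: iterSubst (digits (G^[n] p)) k [s])
    (hdisp : |j * translation (G^[n] p) b| ≤ 1 / (M + 1)) {δ : ℝ} (hδ : 0 ≤ δ)
    (hcount : ∀ s, δ * height (digits p) (n + k) s ≤ r * height (digits p) n b - M) :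
    VisitsWithFrequency (T p) (Set.Icc 0 1) (recurrenceSet p (j * height (digits p) n b) M) δ := by
  obtain ⟨R, hR⟩ := exists_iterate_mem_image_zoom hp (n + k)
  refine visitsWithFrequency_of_return (M := ∑ s, height (digits p) (n + k) s) hδ ?_ hR
  rintro _ ⟨y, hy, rfl⟩
  set s := symbol (G^[n + k] p) y
  have hreturn : (T p)^[height (digits p) (n + k) s] (zoom (scale p (n + k)) y) =
      zoom (scale p (n + k)) (T (G^[n + k] p) y) :=
    ((reads_singleton (G^[n + k] p) y).zoom_iterSubst hp hy).iterate_eq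
  refine ⟨_, height_pos _ _ s, Finset.single_le_sum (fun _ _ => Nat.zero_le _) (Finset.mem_univ s),
    ?_, (hcount s).trans (sub_le_birkhoffSum_recurrenceSet hp hy (hblock s) hdisp)⟩
  rw [hreturn]
  exact Set.mem_image_of_mem _ (mapsTo_T (hp _) hy)

end Recurrence

/-! ### Balanced levels -/

/-- The number of repetitions in `IsBalancedLevel`. It dominates the level and the length of the
word of the letter `2`, which is not repeated. -/
def repetition (d : ℕ → ℕ) (n : ℕ) : ℕ := height d n 2 + 2 * n + 4

/-- The words of the letters `0` and `1` at level `n` have coprime lengths `v` and `w`, and the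
next three digits are such that every word of level `n + 3` mostly consists of about `N * w`
repetitions of the first and about `N * v` repetitions of the second, where `N = repetition d n`.
Each of the two blocks then takes the time `N * v * w`. -/
def IsBalancedLevel (d : ℕ → ℕ) (n : ℕ) : Prop :=
  (height d n 0).Coprime (height d n 1) ∧ d n = repetition d n * height d n 1 ∧
    d (n + 1) = repetition d n * height d n 0 ∧ d (n + 2) = 1

section BalancedLevel

variable {d e : ℕ → ℕ} {p : ℝ × ℝ} {n : ℕ}

theorem repetition_congr (h : ∀ i < n, d i = e i) : repetition d n = repetition e n := by
  rw [repetition, height_congr h, repetition]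

theorem IsBalancedLevel.congr (hd : IsBalancedLevel d n) (h : ∀ i < n + 3, d i = e i) :
    IsBalancedLevel e n := by
  have hn : ∀ i < n, d i = e i := fun i hi => h i (by omega)
  unfold IsBalancedLevel at hd ⊢
  rwa [repetition_congr hn, height_congr hn, height_congr hn, h n (by omega),
    h (n + 1) (by omega), h (n + 2) (by omega)] at hd

theorem subst_replicate_zero (k m : ℕ) : subst k (List.replicate m 0) = List.replicate m 1 := by
  rw [subst, List.flatMap_replicate]
  exact List.flatten_replicate_singleton

theorem prefix_subst_subst_one (l : ℕ) (s : Fin 3) :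
    [2] ++ List.replicate l 0 <+: subst (l + 1) (subst 1 [s]) := by
  fin_cases s
  · exact ⟨[0], by simp [subst, letterWord, List.replicate_succ']⟩
  · exact ⟨[1], by simp [subst, letterWord]⟩
  · exact ⟨[], by simp [subst, letterWord]⟩

theorem prefix_iterSubst_three (h : d 2 = 1) {k l : ℕ} (hk : d 0 = k + 1) (hl : d 1 = l + 1)
    (s : Fin 3) : [2] ++ List.replicate k 0 ++ List.replicate l 1 <+: iterSubst d 3 [s] := by
  simp only [iterSubst]
  rw [h, hk, hl]
  obtain ⟨u, hu⟩ := prefix_subst_subst_one l s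
  have htwo : subst (k + 1) [2] = [2] ++ List.replicate k 0 := by simp [subst, letterWord]
  rw [← hu, subst_append, subst_append, subst_replicate_zero, htwo]
  exact List.prefix_append _ _

theorem replicate_zero_infix_iterSubst (h : d 2 = 1) {k : ℕ} (hk : k < d 0) (hd : d 1 ≠ 0)
    (s : Fin 3) : List.replicate k 0 <:+: iterSubst d 3 [s] := by
  obtain ⟨l, hl⟩ := Nat.exists_eq_add_one_of_ne_zero hd
  obtain ⟨m, hm⟩ := Nat.exists_eq_add_of_lt hk
  refine List.IsInfix.trans ?_ (prefix_iterSubst_three h hm hl s).isInfix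
  rw [List.replicate_add]
  exact ⟨[2], List.replicate m 0 ++ List.replicate l 1, by simp only [List.append_assoc]⟩

theorem replicate_one_infix_iterSubst (h : d 2 = 1) (hd : d 0 ≠ 0) {l : ℕ} (hl : l < d 1)
    (s : Fin 3) : List.replicate l 1 <:+: iterSubst d 3 [s] := by
  obtain ⟨k, hk⟩ := Nat.exists_eq_add_one_of_ne_zero hd
  obtain ⟨m, hm⟩ := Nat.exists_eq_add_of_lt hl
  refine List.IsInfix.trans ?_ (prefix_iterSubst_three h hk hm s).isInfix
  rw [List.replicate_add]
  exact ⟨[2] ++ List.replicate k 0, List.replicate m 1, by simp only [List.append_assoc]⟩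

theorem height_add_three_le (h : d (n + 2) = 1) (s : Fin 3) :
    height d (n + 3) s ≤
      2 * height d n 2 + 2 * (d n * height d n 0) + d (n + 1) * height d n 1 := by
  have hzero : (d n - 1) * height d n 0 ≤ d n * height d n 0 := by gcongr; omega
  have hone : (d (n + 1) - 1) * height d n 1 ≤ d (n + 1) * height d n 1 := by gcongr; omega
  fin_cases s
  · change height d (n + 3) 0 ≤ _
    rw [height_succ_zero, height_succ_one, height_succ_two, height_succ_zero]
    omega
  · change height d (n + 3) 1 ≤ _
    rw [height_succ_one, height_succ_two, height_succ_two, height_succ_zero, height_succ_zero,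
      height_succ_one, h, one_mul]
    omega
  · change height d (n + 3) 2 ≤ _
    rw [height_succ_two, height_succ_two, height_succ_two, height_succ_zero, height_succ_zero, h,
      Nat.sub_self, zero_mul]
    omega

theorem IsBalancedLevel.height_add_three_le (h : IsBalancedLevel d n) (s : Fin 3) :
    height d (n + 3) s ≤ 5 * (repetition d n * (height d n 0 * height d n 1)) := by
  obtain ⟨-, hzero, hone, hlast⟩ := h
  have htwo : height d n 2 ≤ repetition d n * (height d n 0 * height d n 1) :=
    calc height d n 2 ≤ repetition d n := by unfold repetition; omega
      _ ≤ _ := Nat.le_mul_of_pos_right _ (Nat.mul_pos (height_pos d n 0) (height_pos d n 1))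
  calc height d (n + 3) s
      ≤ 2 * height d n 2 + 2 * (d n * height d n 0) + d (n + 1) * height d n 1 :=
        ITM.height_add_three_le hlast s
    _ = 2 * height d n 2 + 3 * (repetition d n * (height d n 0 * height d n 1)) := by
        rw [hzero, hone]; ring
    _ ≤ 5 * (repetition d n * (height d n 0 * height d n 1)) := by omega

theorem IsBalancedLevel.height_add_le (h : IsBalancedLevel d n) (s : Fin 3) {v w j r : ℕ}
    (hvw : v * w = height d n 0 * height d n 1) (hj : j ≤ w) (hr : j + r + 1 = repetition d n * w) :
    height d (n + 3) s + 10 * n ≤ 10 * (r * v) := by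
  have hpos : 0 < v * w := hvw ▸ Nat.mul_pos (height_pos d n 0) (height_pos d n 1)
  have hheight := h.height_add_three_le s
  rw [← hvw] at hheight
  have hrep : (2 * n + 4) * (v * w) ≤ repetition d n * (v * w) := by
    gcongr
    unfold repetition
    omega
  have hblock : (j + r + 1) * v = repetition d n * (v * w) := by rw [hr]; ring
  have hjv : j * v ≤ v * w := by rw [Nat.mul_comm v]; gcongr
  have hv : v ≤ v * w := Nat.le_mul_of_pos_right _ (Nat.pos_of_mul_pos_left hpos)
  have hn : n ≤ n * (v * w) := Nat.le_mul_of_pos_right _ hpos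
  rw [add_mul, add_mul, one_mul] at hblock
  rw [add_mul, mul_assoc] at hrep
  omega

theorem IsBalancedLevel.one_div_ten_mul_height_le (h : IsBalancedLevel d n) (s : Fin 3)
    {v w j r : ℕ} (hvw : v * w = height d n 0 * height d n 1) (hj : j ≤ w)
    (hr : j + r + 1 = repetition d n * w) :
    (1 / 10 : ℝ) * height d (n + 3) s ≤ r * v - n := by
  have hcast : (height d (n + 3) s + 10 * n : ℝ) ≤ 10 * (r * v) := by
    exact_mod_cast h.height_add_le s hvw hj hr
  linarith

theorem abs_mul_le_one_div {i v m N : ℕ} {x : ℝ} (hx : 0 ≤ x) (hNv : (N * v : ℕ) * x ≤ 1)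
    (hi : i ≤ v) (hN : m + 1 ≤ N) : |i * x| ≤ 1 / (m + 1) := by
  rw [abs_of_nonneg (by positivity), le_div_iff₀ (by positivity)]
  calc (i : ℝ) * x * (m + 1 : ℝ) ≤ v * x * N := by gcongr; exact_mod_cast hN
    _ = (N * v : ℕ) * x := by push_cast; ring
    _ ≤ 1 := hNv

theorem IsBalancedLevel.visitsWithFrequency_zero (hp : p ∈ OmegaInfty)
    (h : IsBalancedLevel (digits p) n) {j : ℕ} (hj : j ≤ height (digits p) n 1) :
    VisitsWithFrequency (T p) (Set.Icc 0 1)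
      (recurrenceSet p (j * height (digits p) n 0) n) (1 / 10) := by
  obtain ⟨-, hzero, -, hlast⟩ := id h
  have hN : n + 2 ≤ repetition (digits p) n := by unfold repetition; omega
  have hlt : j + 1 ≤ digits p n := by
    rw [hzero]
    nlinarith [height_pos (digits p) n 1]
  obtain ⟨r, hr⟩ := Nat.exists_eq_add_of_le' hlt
  refine visitsWithFrequency_recurrenceSet (k := 3) (r := r) hp (fun s => ?_) ?_ (by norm_num)
    fun s => h.one_div_ten_mul_height_le s rfl hj (by omega)
  · rw [digits_iterate]
    exact replicate_zero_infix_iterSubst hlast (show j + r < digits p n by omega)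
      (Nat.one_le_iff_ne_zero.1 (one_le_digit (hp (n + 1)))) s
  · refine abs_mul_le_one_div (fst_pos (hp n)).le ?_ hj (by omega : n + 1 ≤ repetition (digits p) n)
    rw [← hzero]
    exact ((isExpansion_digits hp).digit_mul_lt_one n).le

theorem IsBalancedLevel.visitsWithFrequency_one (hp : p ∈ OmegaInfty)
    (h : IsBalancedLevel (digits p) n) {i : ℕ} (hi : i ≤ height (digits p) n 0) :
    VisitsWithFrequency (T p) (Set.Icc 0 1)
      (recurrenceSet p (i * height (digits p) n 1) n) (1 / 10) := by
  obtain ⟨-, -, hone, hlast⟩ := id h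
  have hN : n + 2 ≤ repetition (digits p) n := by unfold repetition; omega
  have hlt : i + 1 ≤ digits p (n + 1) := by
    rw [hone]
    nlinarith [height_pos (digits p) n 0]
  obtain ⟨r, hr⟩ := Nat.exists_eq_add_of_le' hlt
  refine visitsWithFrequency_recurrenceSet (k := 3) (r := r) hp (fun s => ?_) ?_ (by norm_num)
    fun s => h.one_div_ten_mul_height_le s (mul_comm _ _) hi (by omega)
  · rw [digits_iterate]
    exact replicate_one_infix_iterSubst hlast (Nat.one_le_iff_ne_zero.1 (one_le_digit (hp n)))
      (show i + r < digits p (n + 1) by omega) s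
  · have hpos : 0 < (G^[n + 1] p).1 := fst_pos (hp (n + 1))
    have hsnd : (G^[n] p).2 ≤ (G^[n + 1] p).1 := by
      rw [snd_eq (hp n), ← Function.iterate_succ_apply' G]
      exact mul_le_of_le_one_left hpos.le (fst_mem_Ioc (hp n)).2
    refine abs_mul_le_one_div (mem_interior_U.1 (hp n)).1.le ?_ hi
      (by omega : n + 1 ≤ repetition (digits p) n)
    rw [← hone]
    exact (mul_le_mul_of_nonneg_left hsnd (Nat.cast_nonneg _)).trans
      ((isExpansion_digits hp).digit_mul_lt_one (n + 1)).le

theorem IsBalancedLevel.exists_consecutive_visitsWithFrequency (hp : p ∈ OmegaInfty)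
    (h : IsBalancedLevel (digits p) n) :
    ∃ a, VisitsWithFrequency (T p) (Set.Icc 0 1) (recurrenceSet p a n) (1 / 10) ∧
      VisitsWithFrequency (T p) (Set.Icc 0 1) (recurrenceSet p (a + 1) n) (1 / 10) := by
  obtain ⟨i, hi, j, hj, hij⟩ :=
    exists_mul_eq_mul_add_one (height_pos (digits p) n 0) (height_pos (digits p) n 1) h.1
  exact ⟨_, h.visitsWithFrequency_one hp hi, hij ▸ h.visitsWithFrequency_zero hp hj⟩

end BalancedLevel

/-! ### Generic parameters -/

section Generic

variable {d : ℕ → ℕ} {p : ℝ × ℝ}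

theorem exists_coprime_height_succ (hd : ∀ i, 1 ≤ d i) (n : ℕ) :
    ∃ e : ℕ → ℕ, (∀ i, 1 ≤ e i) ∧ (∀ i < n, e i = d i) ∧
      (height e (n + 1) 0).Coprime (height e (n + 1) 1) := by
  obtain ⟨k, hk, hcoprime⟩ :=
    exists_coprime_add_mul (height_pos d n 1).ne' (coprime_height_gcd_height hd n)
  have hagree : ∀ i < n, Function.update d n k i = d i := fun i hi =>
    Function.update_of_ne hi.ne _ _
  refine ⟨Function.update d n k, fun i => ?_, hagree, ?_⟩
  · rcases eq_or_ne i n with rfl | hi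
    · rwa [Function.update_self]
    · exact (Function.update_of_ne hi k d).symm ▸ hd i
  · rwa [height_succ_zero, height_succ_one, Function.update_self, height_congr hagree,
      height_congr hagree, height_congr hagree]

theorem exists_isBalancedLevel {n : ℕ} (hd : ∀ i, 1 ≤ d i)
    (h : (height d n 0).Coprime (height d n 1)) :
    ∃ e : ℕ → ℕ, (∀ i, 1 ≤ e i) ∧ (∀ i < n, e i = d i) ∧ IsBalancedLevel e n := by
  set e : ℕ → ℕ := fun i =>
    if i < n then d i
    else if i = n then repetition d n * height d n 1
    else if i = n + 1 then repetition d n * height d n 0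
    else 1 with he
  have hagree : ∀ i < n, e i = d i := fun i hi => if_pos hi
  have hrep : 0 < repetition d n := by unfold repetition; omega
  refine ⟨e, fun i => ?_, hagree, ?_⟩
  · simp only [he]
    split_ifs
    exacts [hd i, Nat.mul_pos hrep (height_pos d n 1), Nat.mul_pos hrep (height_pos d n 0), le_rfl]
  · rw [IsBalancedLevel, repetition_congr hagree, height_congr hagree, height_congr hagree]
    exact ⟨h, by simp [he], by simp [he], by simp [he]⟩

theorem isOpen_setOf_isBalancedLevel (n : ℕ) :
    IsOpen {p : OmegaInfty | IsBalancedLevel (digits p) n} := by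
  refine isOpen_iff_mem_nhds.2 fun p hp => ?_
  filter_upwards [continuous_subtype_val.continuousAt.eventually
    (eventually_digits_eq p.2 (n + 3))] with q hq
  exact IsBalancedLevel.congr hp fun i hi => (hq i hi).symm

theorem exists_dist_lt_isBalancedLevel (hp : p ∈ OmegaInfty) (m : ℕ) {ε : ℝ} (hε : 0 < ε) :
    ∃ q ∈ OmegaInfty, dist q p < ε ∧ ∃ n ≥ m, IsBalancedLevel (digits q) n := by
  obtain ⟨n, hn⟩ := exists_dist_lt_of_digits_eq hp hε
  obtain ⟨d, hd, hdp, hcoprime⟩ :=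
    exists_coprime_height_succ (fun i => one_le_digit (hp i)) (max n m)
  obtain ⟨e, he, hed, hbalanced⟩ := exists_isBalancedLevel hd hcoprime
  obtain ⟨q, hq, hqe⟩ := exists_digits_eq hp he (max n m + 1 + 3)
  refine ⟨q, hq, hn q hq fun i hi => ?_, max n m + 1, by omega,
    hbalanced.congr fun i hi => (hqe i hi).symm⟩
  rw [hqe i (by omega), hed i (by omega), hdp i (by omega), digits]

/-- The parameters with infinitely many balanced levels. -/
def genericSet : Set OmegaInfty :=
  ⋂ m : ℕ, ⋃ n ≥ m, {p : OmegaInfty | IsBalancedLevel (digits p) n}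

theorem isGδ_genericSet : IsGδ genericSet :=
  IsGδ.iInter_of_isOpen fun _ => isOpen_biUnion fun n _ => isOpen_setOf_isBalancedLevel n

theorem dense_genericSet : Dense genericSet := by
  have : BaireSpace OmegaInfty := isGδ_OmegaInfty.baireSpace_of_t2Space_locallyCompactSpace
  refine dense_iInter_of_isOpen (fun m => isOpen_biUnion fun n _ => isOpen_setOf_isBalancedLevel n)
    fun m => Metric.dense_iff.2 fun p ε hε => ?_
  obtain ⟨q, hq, hdist, n, hn, hbalanced⟩ := exists_dist_lt_isBalancedLevel p.2 m hε
  exact ⟨⟨q, hq⟩, hdist, Set.mem_biUnion hn hbalanced⟩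

theorem exists_recurrence_times {p : OmegaInfty} (hp : p ∈ genericSet) (l : ℕ) :
    ∃ a, VisitsWithFrequency (T p) (Set.Icc 0 1) (recurrenceSet p a l) (1 / 10) ∧
      VisitsWithFrequency (T p) (Set.Icc 0 1) (recurrenceSet p (a + 1) l) (1 / 10) := by
  obtain ⟨n, hn, hbalanced⟩ := Set.mem_iUnion₂.1 (Set.mem_iInter.1 hp l)
  obtain ⟨a, ha, ha'⟩ := hbalanced.exists_consecutive_visitsWithFrequency p.2
  exact ⟨a, ha.mono (recurrenceSet_anti _ _ hn), ha'.mono (recurrenceSet_anti _ _ hn)⟩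

end Generic

section Eigenvalue

variable {p : ℝ × ℝ} {c : ℂ} {δ : ℝ} {a : ℕ → ℕ}

theorem IsContinuousEigenvalue.tendsto_pow (h : IsContinuousEigenvalue p c) (hc : ‖c‖ = 1)
    (hδ : 0 < δ)
    (ha : ∀ l, VisitsWithFrequency (T p) (Set.Icc 0 1) (recurrenceSet p (a l) l) δ) :
    Tendsto (fun l => c ^ a l) atTop (𝓝 1) := by
  obtain ⟨φ, hφ, hφ0, hφc⟩ := h
  refine tendsto_pow_of_continuous_eigenfunction hc hφ hφ0 hφc fun l => ?_
  obtain ⟨i, -, hsymbol⟩ := (ha l).exists_iterate_mem hδ (Set.right_mem_Icc.2 zero_le_one)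
  refine ⟨i, fun t ht => ?_⟩
  rw [itinerary, itinerary, add_comm i, Function.iterate_add_apply _ t,
    Function.iterate_add_apply _ t, Function.iterate_add_apply _ (a l)]
  exact (hsymbol t ht).symm

theorem IsMeasurableEigenvalue.tendsto_pow (h : IsMeasurableEigenvalue p c) (hc : ‖c‖ = 1)
    (hδ : 0 < δ)
    (ha : ∀ l, VisitsWithFrequency (T p) (Set.Icc 0 1) (recurrenceSet p (a l) l) δ) :
    Tendsto (fun l => c ^ a l) atTop (𝓝 1) := by
  obtain ⟨μ, _, hμ, hT, f, hf, hf0, hfc⟩ := h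
  exact tendsto_pow_of_measurable_eigenfunction hT hμ hc (hf.integrable one_le_two) hf0 hfc hδ
    tendsto_one_div_add_atTop_nhds_zero_nat fun l => (ha l).mono fun _ hx => hx.1

theorem eq_one_of_isEigenvalue {p : OmegaInfty} (hp : p ∈ genericSet) (hc : ‖c‖ = 1)
    (h : IsEigenvalue p c) : c = 1 := by
  choose a ha ha' using exists_recurrence_times hp
  have hδ : (0 : ℝ) < 1 / 10 := by norm_num
  exact h.elim (fun h => eq_one_of_tendsto_pow (h.tendsto_pow hc hδ ha) (h.tendsto_pow hc hδ ha'))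
    fun h => eq_one_of_tendsto_pow (h.tendsto_pow hc hδ ha) (h.tendsto_pow hc hδ ha')

theorem exp_two_pi_mul_ne_one {ξ : ℝ} (hξ : ξ ∈ Set.Ioo (0 : ℝ) 1) :
    Complex.exp (2 * Real.pi * Complex.I * ξ) ≠ 1 := by
  intro h
  obtain ⟨n, hn⟩ := Complex.exp_eq_one_iff.1 h
  have hcast : (ξ : ℂ) = n := mul_left_cancel₀ Complex.two_pi_I_ne_zero (by rw [hn]; ring)
  obtain rfl : ξ = n := by exact_mod_cast hcast
  have hpos : 0 < n := by exact_mod_cast hξ.1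
  have hlt : n < 1 := by exact_mod_cast hξ.2
  omega

theorem norm_exp_two_pi_mul (ξ : ℝ) : ‖Complex.exp (2 * Real.pi * Complex.I * ξ)‖ = 1 := by
  rw [show (2 * Real.pi * Complex.I * ξ : ℂ) = ((2 * Real.pi * ξ : ℝ) : ℂ) * Complex.I by
    push_cast; ring]
  exact Complex.norm_exp_ofReal_mul_I _

end Eigenvalue

end ITM

theorem mainTheorem4 :
    ∃ S : Set ITM.OmegaInfty, IsGδ S ∧ Dense S ∧
      S ⊆ {p : ITM.OmegaInfty | ¬ ∃ ξ ∈ Set.Ioo (0 : ℝ) 1,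
        ITM.IsEigenvalue (p : ℝ × ℝ) (Complex.exp (2 * Real.pi * Complex.I * ξ))} := by
  refine ⟨ITM.genericSet, ITM.isGδ_genericSet, ITM.dense_genericSet, ?_⟩
  rintro p hp ⟨ξ, hξ, h⟩
  exact ITM.exp_two_pi_mul_ne_one hξ
    (ITM.eq_one_of_isEigenvalue hp (ITM.norm_exp_two_pi_mul ξ) h)
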